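/- Let $X$ be a Polish space, that is, a complete separable metric space with metric $d$, and let $\mathcal{K}(X)$ be the space of non-empty compact subsets of $X$ with the Hausdorff metric. A gauge function is a non-decreasing, right-continuous function $h\colon[0,\infty)\to[0,\infty)$ such that $h(x)=0$ if and only if $x=0$. For $A\subseteq X$ and $\delta>0$ put $$\mathcal{H}^{h}_{\delta}(A)=\inf\Big\{\sum_{i=1}^{\infty}h(\operatorname{diam}A_i)\;:\;A\subseteq\bigcup_{i=1}^{\infty}A_i,\ \operatorname{diam}A_i\le\delta\text{ for all }i\Big\},\qquad \mathcal{H}^{h}(A)=\lim_{\delta\to0+}\mathcal{H}^{h}_{\delta}(A),$$ where the $A_i$ are arbitrary subsets of $X$ and $\operatorname{diam}\emptyset=0$ (and $\inf\emptyset=\infty$). For $K\subseteq X$, a map $f\colon K\to X$ is a weak contraction if $d(f(x),f(y))<d(x,y)$ for all $x,y\in K$ with $x\ne y$. Then the set of all $K\in\mathcal{K}(X)$ with the following property is co-meager in $\mathcal{K}(X)$ (its complement is a countable union of nowhere dense sets): either $K$ is finite, or there is a continuous gauge function $h$ such that $0<\mathcal{H}^{h}(K)<\infty$ and, for every weak contraction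 $f\colon K\to X$, $\mathcal{H}^{h}(K\cap f(K))=0$. -/

import Mathlib

open Set Filter Topology TopologicalSpace
open scoped NNReal ENNReal

/-- A gauge function `h : [0,∞) → [0,∞)`: non-decreasing, right-continuous, and `h x = 0` if and
only if `x = 0`. -/
structure IsGaugeFunction (h : ℝ≥0 → ℝ≥0) : Prop where
  monotone : Monotone h
  rightContinuous : ∀ x : ℝ≥0, ContinuousWithinAt h (Ici x) x
  eq_zero_iff : ∀ x : ℝ≥0, h x = 0 ↔ x = 0

/-- The size-`δ` approximation `H^h_δ(A)`: the infimum of `∑ h (diam Aᵢ)` over all countable covers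
`(Aᵢ)` of `A` by arbitrary subsets of `X` of diameter at most `δ`. The constraint is put on the
extended diameter, so that it excludes unbounded sets; for the admissible sets the extended diameter
is finite and `toNNReal` is its actual value (and `0` for the empty set). -/
noncomputable def gaugeHausdorffPre {X : Type*} [MetricSpace X] (h : ℝ≥0 → ℝ≥0) (δ : ℝ≥0)
    (A : Set X) : ℝ≥0∞ :=
  ⨅ (U : ℕ → Set X) (_ : A ⊆ ⋃ i, U i) (_ : ∀ i, Metric.ediam (U i) ≤ (δ : ℝ≥0∞)),
    ∑' i, (h (Metric.ediam (U i)).toNNReal : ℝ≥0∞)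

/-- The `h`-Hausdorff (outer) measure `H^h(A)`, the limit of `H^h_δ(A)` as `δ → 0+`. As `H^h_δ(A)`
grows when `δ` decreases, the limit is the supremum over `δ > 0`; see
`tendsto_gaugeHausdorffPre`. -/
noncomputable def gaugeHausdorff {X : Type*} [MetricSpace X] (h : ℝ≥0 → ℝ≥0)
    (A : Set X) : ℝ≥0∞ :=
  ⨆ (δ : ℝ≥0) (_ : 0 < δ), gaugeHausdorffPre h δ A

theorem gaugeHausdorffPre_anti {X : Type*} [MetricSpace X] (h : ℝ≥0 → ℝ≥0) (A : Set X) :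
    Antitone fun δ : ℝ≥0 => gaugeHausdorffPre h δ A := by
  intro δ ε hδε
  refine le_iInf fun U => le_iInf fun hU => le_iInf fun hd => ?_
  exact iInf_le_of_le U (iInf_le_of_le hU (iInf_le_of_le
    (fun i => (hd i).trans (by exact_mod_cast hδε)) le_rfl))

/-- `H^h(A)` is the limit of `H^h_δ(A)` as `δ → 0+`. -/
theorem tendsto_gaugeHausdorffPre {X : Type*} [MetricSpace X] (h : ℝ≥0 → ℝ≥0) (A : Set X) :
    Tendsto (fun δ : ℝ≥0 => gaugeHausdorffPre h δ A) (𝓝[>] 0) (𝓝 (gaugeHausdorff h A)) := by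
  rw [← tendsto_comp_coe_Ioi_atBot]
  have : gaugeHausdorff h A = ⨆ δ : Ioi (0 : ℝ≥0), gaugeHausdorffPre h δ A := by
    simp only [gaugeHausdorff, iSup_subtype']
    rfl
  rw [this]
  exact tendsto_atBot_iSup fun r r' hr => gaugeHausdorffPre_anti h A hr

/-- A weak contraction between metric spaces: it strictly decreases the distance of any two distinct
points. -/
def IsWeakContraction {Y Z : Type*} [MetricSpace Y] [MetricSpace Z] (f : Y → Z) : Prop :=
  ∀ x y : Y, x ≠ y → dist (f x) (f y) < dist x y

/-! Up to a finite set E of isolated points of X, a generic infinite K carries a uniform tree of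
clusters (`IsClusterScheme`): well separated balls of radius ε n about N n centres, each containing
exactly k n centres of the next level. The gauge is of order 1 / N n at the scale of level n, so all
clusters of a level have equal share and the measure of K is finite and positive
(`gaugeHausdorff_lt_top`, `gaugeHausdorff_pos`).

The children are placed so that a nonexpansive map is inefficient between clusters: for x ≠ y, the
image of cluster x meets at most k n / N n children of cluster y (`HasFewContractions`). Points
moved by at least 2 * ε n leave their cluster, so their images meet at most k n of the N n * k n
clusters of level n + 1, a share 1 / N n tending to 0. Apart from countably many points, this
exhausts K ∩ f(K) (`gaugeHausdorff_inter_range`).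

Such children come from `exists_refinement`, which splits points twice, with the scales ordered one
way across clusters in the first split and the opposite way in the second. For any x ≠ y, one of the
two splits is coarser over y than over x, and a nonexpansive map cannot spread points that much.

With centres in a countable dense set and radii 2⁻ʲ there are countably many approximation data.
Each can be refined arbitrarily near every compact set it approximates, so for a residual set of K
refinement never stops. -/

/-! ### Splitting finite sets at ordered scales -/

theorem exists_pos_le_of_finite {α : Type*} [Finite α] (p : α → Prop) (f : α → ℝ)
    (h : ∀ a, p a → 0 < f a) : ∃ η > 0, ∀ a, p a → η ≤ f a := by
  have key : ∀ᶠ η : ℝ in 𝓝[>] 0, ∀ a, p a → η ≤ f a := by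
    refine eventually_all.2 fun a => ?_
    by_cases ha : p a
    · filter_upwards [Ioc_mem_nhdsGT (h a ha)] with η hη _ using hη.2
    · exact Eventually.of_forall fun _ h => absurd h ha
  obtain ⟨η, hη, hpos⟩ := (key.and self_mem_nhdsWithin).exists
  exact ⟨η, hpos, hη⟩

theorem exists_injective_mem_of_infinite {ι X : Type*} [Finite ι] (A : ι → Set X)
    (hA : ∀ i, (A i).Infinite) : ∃ c : ι → X, Function.Injective c ∧ ∀ i, c i ∈ A i := by
  classical
  have key : ∀ s : Finset ι, ∃ c : ι → X, InjOn c s ∧ ∀ i ∈ s, c i ∈ A i := by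
    intro s
    induction s using Finset.induction_on with
    | empty => exact ⟨fun i => (hA i).nonempty.some, by simp, by simp⟩
    | insert j s hj ih =>
      obtain ⟨c, hc, hcA⟩ := ih
      obtain ⟨z, hz, hzs⟩ := (hA j).exists_notMem_finset (s.image c)
      have hne : ∀ i ∈ s, i ≠ j := fun i hi h => hj (h ▸ hi)
      have hzc : ∀ i ∈ s, c i ≠ z := fun i hi h => hzs (Finset.mem_image.2 ⟨i, hi, h⟩)
      refine ⟨Function.update c j z, ?_, ?_⟩
      · intro a ha b hb hab
        rw [Finset.mem_coe, Finset.mem_insert] at ha hb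
        rcases ha with rfl | ha <;> rcases hb with rfl | hb
        · rfl
        · rw [Function.update_self, Function.update_of_ne (hne b hb)] at hab
          exact absurd hab.symm (hzc b hb)
        · rw [Function.update_self, Function.update_of_ne (hne a ha)] at hab
          exact absurd hab (hzc a ha)
        · rw [Function.update_of_ne (hne a ha), Function.update_of_ne (hne b hb)] at hab
          exact hc ha hb hab
      · intro i hi
        rcases Finset.mem_insert.1 hi with rfl | hi
        · simpa using hz
        · rw [Function.update_of_ne (hne i hi)]
          exact hcA i hi
  have := Fintype.ofFinite ι
  obtain ⟨c, hc, hcA⟩ := key Finset.univ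
  exact ⟨c, by simpa [injOn_univ] using hc, fun i => hcA i (Finset.mem_univ i)⟩

/-- Each of finitely many distinct centres is split into `m` nearby points. The scales of the
resulting groups decrease strictly with the rank of the centre. -/
theorem exists_split {X ι : Type*} [MetricSpace X] [Finite ι] {D : Set X} {c : ι → X}
    (hc : Function.Injective c) (hD : ∀ i, ∀ ρ > 0, (Metric.ball (c i) ρ ∩ D).Infinite)
    (rank : ι → ℕ) (m : ℕ) {ρ : ℝ} (hρ : 0 < ρ) :
    ∃ q : ι × Fin m → X, (∀ a, q a ∈ D ∧ dist (q a) (c a.1) < ρ) ∧ ∃ η > 0,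
      (∀ a b, a ≠ b → η ≤ dist (q a) (q b)) ∧
      ∀ a b, a ≠ b → ∀ i l l', (a.1 = b.1 → rank a.1 < rank i) →
        dist (q (i, l)) (q (i, l')) + η ≤ dist (q a) (q b) := by
  obtain ⟨σ, hσ, hcσ⟩ := exists_pos_le_of_finite (fun p : ι × ι => p.1 ≠ p.2)
    (fun p => dist (c p.1) (c p.2)) fun p hp => dist_pos.2 (hc.ne hp)
  -- Group diameters are then at most σ / 4, while points of different groups stay at least 3σ / 4
  -- apart.
  set ρ₀ := min ρ (σ / 8) with hρ₀
  have hρ₀pos : 0 < ρ₀ := by positivity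
  have hρ₀ρ : ρ₀ ≤ ρ := min_le_left _ _
  have hρ₀σ : ρ₀ ≤ σ / 8 := min_le_right _ _
  -- Groups are placed in order of rank. Values of q on groups of rank at least R are placeholders.
  have key : ∀ R : ℕ, ∃ q : ι × Fin m → X,
      (∀ a, rank a.1 < R → q a ∈ D ∧ dist (q a) (c a.1) < ρ₀) ∧
      (∀ a b, a ≠ b → a.1 = b.1 → rank a.1 < R → 0 < dist (q a) (q b)) ∧
      ∀ a b, a ≠ b → a.1 = b.1 → ∀ i l l', rank a.1 < rank i → rank i < R →
        dist (q (i, l)) (q (i, l')) < dist (q a) (q b) := by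
    intro R
    induction R with
    | zero => exact ⟨fun a => c a.1, by simp, by simp, by simp⟩
    | succ R ih =>
      obtain ⟨q, hq1, hq2, hq3⟩ := ih
      obtain ⟨τ, hτ, hqτ⟩ := exists_pos_le_of_finite
        (fun p : (ι × Fin m) × (ι × Fin m) => p.1 ≠ p.2 ∧ p.1.1 = p.2.1 ∧ rank p.1.1 < R)
        (fun p => dist (q p.1) (q p.2)) fun p hp => hq2 _ _ hp.1 hp.2.1 hp.2.2
      -- τ bounds from below the distances inside groups already placed; the new groups lie in balls
      -- of radius τ / 2, so their diameters are below τ.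
      set τ₀ := min ρ₀ (τ / 2)
      have hτ₀ : 0 < τ₀ := by positivity
      have hs : ∀ i, ∃ s : Fin m → X, Function.Injective s ∧
          ∀ l, s l ∈ Metric.ball (c i) τ₀ ∩ D := fun i =>
        exists_injective_mem_of_infinite _ fun _ => hD i τ₀ hτ₀
      choose s hsinj hs using hs
      refine ⟨fun a => if rank a.1 < R then q a else s a.1 a.2, ?_, ?_, ?_⟩
      · intro a ha
        by_cases h : rank a.1 < R
        · simpa [h] using hq1 a h
        · simp only [h, if_false]
          exact ⟨(hs _ _).2, (Metric.mem_ball.1 (hs _ _).1).trans_le (min_le_left _ _)⟩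
      · rintro ⟨i, j⟩ ⟨i', j'⟩ hab h ha
        obtain rfl : i = i' := h
        by_cases h : rank i < R
        · simpa [h] using hq2 _ _ hab rfl h
        · simp only [h, if_false]
          exact dist_pos.2 ((hsinj i).ne fun hj => hab (by rw [hj]))
      · rintro ⟨i, j⟩ ⟨i', j'⟩ hab h i₂ l l' hr hR
        obtain rfl : i = i' := h
        have hi : rank i < R := by simp only at hr; omega
        by_cases h : rank i₂ < R
        · simpa [h, hi] using hq3 _ _ hab rfl i₂ l l' hr h
        · simp only [h, hi, if_false, if_true]
          have h1 := Metric.mem_ball.1 (hs i₂ l).1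
          have h2 := Metric.mem_ball'.1 (hs i₂ l').1
          have h3 := dist_triangle (s i₂ l) (c i₂) (s i₂ l')
          have h4 := hqτ ((i, j), (i, j')) ⟨hab, rfl, hi⟩
          have h5 : τ₀ ≤ τ / 2 := min_le_right _ _
          simp only at h4
          linarith
  obtain ⟨R, hR⟩ : ∃ R, ∀ i, rank i < R := by
    obtain ⟨R, hR⟩ := (Set.finite_range rank).bddAbove
    exact ⟨R + 1, fun i => Nat.lt_succ_of_le (hR (mem_range_self i))⟩
  obtain ⟨q, hq1, hq2, hq3⟩ := key R
  have hlt : ∀ a b, a ≠ b → ∀ i l l', (a.1 = b.1 → rank a.1 < rank i) →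
      dist (q (i, l)) (q (i, l')) < dist (q a) (q b) := by
    intro a b hab i l l' h
    by_cases h1 : a.1 = b.1
    · exact hq3 a b hab h1 i l l' (h h1) (hR i)
    · have h2 := hcσ (a.1, b.1) h1
      have h3 := (hq1 a (hR _)).2
      have h4 := (hq1 b (hR _)).2
      have h5 := (hq1 (i, l) (hR _)).2
      have h6 := (hq1 (i, l') (hR _)).2
      have h7 := dist_triangle_right (q (i, l)) (q (i, l')) (c i)
      have h8 := dist_triangle4 (c a.1) (q a) (q b) (c b.1)
      rw [dist_comm] at h3
      simp only at h2 h5 h6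
      linarith
  obtain ⟨η₁, hη₁, h₁⟩ := exists_pos_le_of_finite
    (fun p : (ι × Fin m) × (ι × Fin m) => p.1 ≠ p.2) (fun p => dist (q p.1) (q p.2)) fun p hp => by
      by_cases h1 : p.1.1 = p.2.1
      · exact hq2 _ _ hp h1 (hR _)
      · exact dist_nonneg.trans_lt (hlt _ _ hp p.1.1 p.1.2 p.1.2 fun h => absurd h h1)
  obtain ⟨η₂, hη₂, h₂⟩ := exists_pos_le_of_finite
    (fun p : ((ι × Fin m) × (ι × Fin m)) × ι × Fin m × Fin m =>
      p.1.1 ≠ p.1.2 ∧ (p.1.1.1 = p.1.2.1 → rank p.1.1.1 < rank p.2.1))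
    (fun p => dist (q p.1.1) (q p.1.2) - dist (q (p.2.1, p.2.2.1)) (q (p.2.1, p.2.2.2)))
    fun p hp => sub_pos.2 (hlt _ _ hp.1 _ _ _ hp.2)
  refine ⟨q, fun a => ⟨(hq1 a (hR _)).1, (hq1 a (hR _)).2.trans_le hρ₀ρ⟩, min η₁ η₂,
    lt_min hη₁ hη₂, fun a b hab => (min_le_left _ _).trans (h₁ (a, b) hab), ?_⟩
  intro a b hab i l l' h
  have := h₂ ((a, b), i, l, l') ⟨hab, h⟩
  have h' : min η₁ η₂ ≤ η₂ := min_le_right _ _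
  simp only at this
  linarith

/-- For distinct `x, y ∈ F`, a map that sends points of `F'` near `x` to points of `F'` near `y` and
increases distances by at most `η` takes few values. -/
def HasFewContractions {X : Type*} [MetricSpace X] (F F' : Finset X) (ε η : ℝ) (k : ℕ) : Prop :=
  ∀ x ∈ F, ∀ y ∈ F, x ≠ y → ∀ B ⊆ F', (∀ b ∈ B, dist b y < ε) → ∀ α : X → X,
    (∀ b ∈ B, α b ∈ F' ∧ dist (α b) x < ε) →
    (∀ b ∈ B, ∀ b' ∈ B, dist b b' ≤ dist (α b) (α b') + η) → B.card * F.card ≤ k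

open Classical in
-- The set F' arises from c by two splits into m points, so k = g * m * m. The first has rank e x,
-- the second m - e x. Whatever the order of e x and e y, one split costs a map from cluster x to
-- cluster y a factor m, and m exceeds the number of clusters.
theorem exists_refinement {X : Type*} [MetricSpace X] {D : Set X} {F : Finset X} {ε : ℝ}
    (hsep : ∀ x ∈ F, ∀ y ∈ F, x ≠ y → 2 * ε ≤ dist x y) {g : ℕ} (hg : 0 < g)
    {c : F × Fin g → X} (hc : Function.Injective c) (hcε : ∀ a, dist (c a) a.1 < ε)
    (hD : ∀ x ∈ F, ∀ z, dist z x < ε → ∀ ρ > 0, (Metric.ball z ρ ∩ D).Infinite)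
    {r : ℝ} (hr : 0 < r) :
    ∃ F' : Finset X, ∃ k ≥ 2, ∃ ε₀ > 0, (∀ y ∈ F', y ∈ D) ∧
      (∀ x ∈ F, (F'.filter fun y => dist y x < ε).card = k) ∧
      (∀ y ∈ F', ∃ a, dist y (c a) < r) ∧ (∀ a, ∃ y ∈ F', dist y (c a) < r) ∧
      (∀ y ∈ F', ∃ x ∈ F, dist y x + ε₀ ≤ ε) ∧
      (∀ y ∈ F', ∀ y' ∈ F', y ≠ y' → 6 * ε₀ ≤ dist y y') ∧
      HasFewContractions F F' ε (4 * ε₀) k := by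
  set m := F.card + 2 with hm
  set e : F → ℕ := fun x => F.equivFin x with he
  have heinj : Function.Injective e := fun x y h => F.equivFin.injective (Fin.ext h)
  have helt : ∀ x, e x < m := fun x => (F.equivFin x).2.trans (by omega)
  obtain ⟨σ, hσ, hcσ⟩ := exists_pos_le_of_finite (fun _ : F × Fin g => True)
    (fun a => ε - dist (c a) a.1) fun a _ => sub_pos.2 (hcε a)
  replace hcσ : ∀ a, dist (c a) a.1 + σ ≤ ε := fun a => by linarith [hcσ a trivial]
  obtain ⟨q₁, hq₁, η₁, hη₁, hq₁η, hq₁s⟩ := exists_split hc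
    (fun a => hD a.1 a.1.2 _ (hcε a)) (fun a => e a.1) m (ρ := min (r / 2) (σ / 4)) (by positivity)
  have hq₁r : ∀ a, dist (q₁ a) (c a.1) < r / 2 := fun a => (hq₁ a).2.trans_le (min_le_left _ _)
  have hq₁σ : ∀ a, dist (q₁ a) (c a.1) < σ / 4 := fun a => (hq₁ a).2.trans_le (min_le_right _ _)
  have hq₁ε : ∀ a, dist (q₁ a) a.1.1 < ε := fun a => by
    linarith [hq₁σ a, hcσ a.1, dist_triangle (q₁ a) (c a.1) a.1.1]
  have hq₁inj : Function.Injective q₁ := fun a b h => by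
    by_contra hab
    have := hq₁η a b hab
    rw [h, dist_self] at this
    linarith
  obtain ⟨q, hq, η₂, hη₂, hqη, hqs⟩ := exists_split hq₁inj
    (fun a => hD a.1.1 a.1.1.2 _ (hq₁ε a)) (fun a => m - e a.1.1) m
    (ρ := min (r / 2) (min (σ / 4) (η₁ / 16))) (by positivity)
  have hqr : ∀ a, dist (q a) (q₁ a.1) < r / 2 := fun a => (hq a).2.trans_le (min_le_left _ _)
  have hqσ : ∀ a, dist (q a) (q₁ a.1) < σ / 4 := fun a =>
    (hq a).2.trans_le ((min_le_right _ _).trans (min_le_left _ _))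
  have hq16 : ∀ a, dist (q a) (q₁ a.1) < η₁ / 16 := fun a =>
    (hq a).2.trans_le ((min_le_right _ _).trans (min_le_right _ _))
  have hqinj : Function.Injective q := fun a b h => by
    by_contra hab
    have := hqη a b hab
    rw [h, dist_self] at this
    linarith
  have hqε : ∀ a, dist (q a) a.1.1.1 + σ / 2 ≤ ε := fun a => by
    linarith [hqσ a, hq₁σ a.1, hcσ a.1.1, dist_triangle4 (q a) (q₁ a.1) (c a.1.1) a.1.1.1]
  have howner : ∀ a, ∀ x (hx : x ∈ F), dist (q a) x < ε → a.1.1.1 = ⟨x, hx⟩ := by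
    intro a x hx h
    by_contra hne
    have h1 := hsep _ a.1.1.1.2 _ hx fun h' => hne (Subtype.ext h')
    have h2 := dist_triangle_left (a.1.1.1 : X) x (q a)
    linarith [hqε a]
  -- σ / 2 keeps the new balls inside the old ones. Passing from q to q₁ costs four errors of η₁ /
  -- 16, and 4 * ε₀ at most η₁ / 4 more, below η₁ in total. The bound η₂ / 8 gives 6 * ε₀ ≤ η₂.
  set ε₀ := min (σ / 2) (min (η₁ / 16) (η₂ / 8)) with hε₀
  have hε₀pos : 0 < ε₀ := by positivity
  have hε₀1 : ε₀ ≤ σ / 2 := min_le_left _ _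
  have hε₀2 : ε₀ ≤ η₁ / 16 := (min_le_right _ _).trans (min_le_left _ _)
  have hε₀3 : ε₀ ≤ η₂ / 8 := (min_le_right _ _).trans (min_le_right _ _)
  have hm0 : 0 < m := by omega
  refine ⟨Finset.univ.image q, g * m * m, ?_, ε₀, hε₀pos, ?_, ?_, ?_, ?_, ?_, ?_, ?_⟩
  · have : 1 * 2 * 1 ≤ g * m * m := by gcongr <;> omega
    simpa using this
  · simp only [Finset.mem_image, Finset.mem_univ, true_and]
    rintro _ ⟨a, rfl⟩
    exact (hq a).1
  · intro x hx
    have : ((Finset.univ.image q).filter fun y => dist y x < ε) =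
        Finset.univ.image fun p : (Fin g × Fin m) × Fin m => q (((⟨x, hx⟩, p.1.1), p.1.2), p.2) := by
      ext y
      simp only [Finset.mem_filter, Finset.mem_image, Finset.mem_univ, true_and]
      constructor
      · rintro ⟨⟨⟨⟨⟨z, i⟩, j⟩, l⟩, rfl⟩, h⟩
        obtain rfl := howner _ x hx h
        exact ⟨((i, j), l), rfl⟩
      · rintro ⟨p, rfl⟩
        refine ⟨⟨_, rfl⟩, ?_⟩
        have := hqε (((⟨x, hx⟩, p.1.1), p.1.2), p.2)
        simp only at this
        linarith
    rw [this, Finset.card_image_of_injective]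
    · simp
    · rintro ⟨⟨i, j⟩, l⟩ ⟨⟨i', j'⟩, l'⟩ h
      have := hqinj h
      simp only [Prod.mk.injEq, true_and] at this ⊢
      exact this
  · simp only [Finset.mem_image, Finset.mem_univ, true_and]
    rintro _ ⟨a, rfl⟩
    exact ⟨a.1.1, by linarith [hqr a, hq₁r a.1, dist_triangle (q a) (q₁ a.1) (c a.1.1)]⟩
  · intro a
    refine ⟨q ((a, ⟨0, hm0⟩), ⟨0, hm0⟩), Finset.mem_image_of_mem _ (Finset.mem_univ _), ?_⟩
    have h1 := hqr ((a, ⟨0, hm0⟩), ⟨0, hm0⟩)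
    have h2 := hq₁r (a, ⟨0, hm0⟩)
    have h3 := dist_triangle (q ((a, ⟨0, hm0⟩), ⟨0, hm0⟩)) (q₁ (a, ⟨0, hm0⟩)) (c a)
    simp only at h1 h2
    linarith
  · simp only [Finset.mem_image, Finset.mem_univ, true_and]
    rintro _ ⟨a, rfl⟩
    exact ⟨_, a.1.1.1.2, by linarith [hqε a]⟩
  · simp only [Finset.mem_image, Finset.mem_univ, true_and]
    rintro _ ⟨a, rfl⟩ _ ⟨b, rfl⟩ hab
    linarith [hqη a b fun h => hab (by rw [h])]
  · intro x hx y hy hxy B hB hBy α hα hαd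
    have hb : ∀ b : B, ∃ p : (Fin g × Fin m) × Fin m,
        q (((⟨y, hy⟩, p.1.1), p.1.2), p.2) = b := by
      rintro ⟨b, hb⟩
      obtain ⟨⟨⟨⟨z, i⟩, j⟩, l⟩, -, rfl⟩ := Finset.mem_image.1 (hB hb)
      obtain rfl := howner _ y hy (hBy _ hb)
      exact ⟨((i, j), l), rfl⟩
    have ha : ∀ b : B, ∃ p : (Fin g × Fin m) × Fin m,
        q (((⟨x, hx⟩, p.1.1), p.1.2), p.2) = α b := by
      rintro ⟨b, hb⟩
      obtain ⟨⟨⟨⟨z, i⟩, j⟩, l⟩, -, h⟩ := Finset.mem_image.1 (hα b hb).1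
      have h2 := (hα b hb).2
      rw [← h] at h2
      obtain rfl := howner _ x hx h2
      exact ⟨((i, j), l), h⟩
    choose s hs using hb
    choose t ht using ha
    have hst : ∀ b b' : B, dist (q (((⟨y, hy⟩, (s b).1.1), (s b).1.2), (s b).2))
          (q (((⟨y, hy⟩, (s b').1.1), (s b').1.2), (s b').2)) ≤
        dist (q (((⟨x, hx⟩, (t b).1.1), (t b).1.2), (t b).2))
          (q (((⟨x, hx⟩, (t b').1.1), (t b').1.2), (t b').2)) + 4 * ε₀ := fun b b' => by
      rw [hs, hs, ht, ht]
      exact hαd b b.2 b' b'.2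
    have hcard : B.card ≤ g * m := by
      rcases lt_trichotomy (e ⟨y, hy⟩) (e ⟨x, hx⟩) with hlt | heq | hlt
      -- The first split is coarser over y: preimages around one centre c are too close together to
      -- reach two different points q₁ over y, so the last index of b determines it.
      · have hinj : Function.Injective fun b : B => ((t b).1.1, (s b).2) := by
          intro b b' h
          simp only [Prod.mk.injEq] at h
          have hd := hst b b'
          by_contra hne
          have hne' : (((⟨y, hy⟩ : F), (s b).1.1), (s b).1.2) ≠
              ((⟨y, hy⟩, (s b').1.1), (s b').1.2) := fun h' => by
            apply hne
            apply Subtype.ext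
            rw [← hs b, ← hs b', h', h.2]
          have h1 := hq₁s _ _ hne' (⟨x, hx⟩, (t b).1.1) (t b).1.2 (t b').1.2 fun _ => hlt
          rw [h.1] at hd h1
          have h2 := hq16 (((⟨y, hy⟩, (s b).1.1), (s b).1.2), (s b).2)
          have h3 := hq16 (((⟨y, hy⟩, (s b').1.1), (s b').1.2), (s b').2)
          have h4 := hq16 (((⟨x, hx⟩, (t b').1.1), (t b).1.2), (t b).2)
          have h5 := hq16 (((⟨x, hx⟩, (t b').1.1), (t b').1.2), (t b').2)
          rw [dist_comm] at h2 h5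
          have h6 := dist_triangle4 (q₁ ((⟨y, hy⟩, (s b).1.1), (s b).1.2))
            (q (((⟨y, hy⟩, (s b).1.1), (s b).1.2), (s b).2))
            (q (((⟨y, hy⟩, (s b').1.1), (s b').1.2), (s b').2))
            (q₁ ((⟨y, hy⟩, (s b').1.1), (s b').1.2))
          have h7 := dist_triangle4 (q (((⟨x, hx⟩, (t b').1.1), (t b).1.2), (t b).2))
            (q₁ ((⟨x, hx⟩, (t b').1.1), (t b).1.2)) (q₁ ((⟨x, hx⟩, (t b').1.1), (t b').1.2))
            (q (((⟨x, hx⟩, (t b').1.1), (t b').1.2), (t b').2))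
          simp only at h2 h3 h4 h5
          linarith
        simpa using Fintype.card_le_of_injective _ hinj
      · exact absurd (congrArg Subtype.val (heinj heq)).symm hxy
      -- The second split is coarser over y: any two points over y are farther apart than the points
      -- of one final group over x.
      · have hinj : Function.Injective fun b : B => (t b).1 := by
          intro b b' h
          simp only at h
          have hd := hst b b'
          by_contra hne
          have hne' : ((((⟨y, hy⟩ : F), (s b).1.1), (s b).1.2), (s b).2) ≠
              (((⟨y, hy⟩, (s b').1.1), (s b').1.2), (s b').2) := fun h' => by
            apply hne
            apply Subtype.ext
            rw [← hs b, ← hs b', h']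
          have h1 := hqs _ _ hne' ((⟨x, hx⟩, (t b).1.1), (t b).1.2) (t b).2 (t b').2
            fun _ => by have := helt ⟨y, hy⟩; simp only; omega
          rw [h] at hd h1
          linarith
        simpa using Fintype.card_le_of_injective _ hinj
    calc B.card * F.card ≤ g * m * m := Nat.mul_le_mul hcard (by omega)
      _ = _ := rfl

/-! ### Gauges as sums of ramps -/

section Gauge

/-- A superposition of ramps: the `n`-th ramp rises from `0` at `2 * ε n` to `a n` at `4 * ε n`. -/
noncomputable def rampGauge (a ε : ℕ → ℝ≥0) (t : ℝ≥0) : ℝ≥0 :=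
  ∑' n, min 1 (t / (2 * ε n) - 1) * a n

variable {a ε : ℕ → ℝ≥0}

theorem ramp_le (t : ℝ≥0) (n : ℕ) : min 1 (t / (2 * ε n) - 1) * a n ≤ a n :=
  mul_le_of_le_one_left zero_le (min_le_left _ _)

theorem summable_ramp (ha : Summable a) (t : ℝ≥0) :
    Summable fun n => min 1 (t / (2 * ε n) - 1) * a n :=
  NNReal.summable_of_le (ramp_le t) ha

theorem monotone_rampGauge (ha : Summable a) : Monotone (rampGauge a ε) := fun s t hst =>
  (summable_ramp ha s).tsum_le_tsum (fun n => by gcongr) (summable_ramp ha t)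

theorem continuous_rampGauge (ha : Summable a) : Continuous (rampGauge a ε) := by
  have h : Continuous fun t : ℝ≥0 => ∑' n, ((min 1 (t / (2 * ε n) - 1) * a n : ℝ≥0) : ℝ) := by
    refine continuous_tsum (u := fun n => (a n : ℝ)) (fun n => ?_) (NNReal.summable_coe.2 ha) ?_
    · fun_prop
    · intro n t
      rw [Real.norm_of_nonneg (NNReal.coe_nonneg _)]
      exact_mod_cast ramp_le t n
  rw [NNReal.isEmbedding_coe.continuous_iff]
  convert h using 2 with t
  exact NNReal.coe_tsum

theorem le_rampGauge (ha : Summable a) {n : ℕ} (hε : 0 < ε n) {t : ℝ≥0} (ht : 4 * ε n ≤ t) :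
    a n ≤ rampGauge a ε t := by
  have h1 : (1 : ℝ≥0) ≤ t / (2 * ε n) - 1 := by
    rw [le_tsub_iff_right, le_div_iff₀ (by positivity)]
    · calc (1 + 1) * (2 * ε n) = 4 * ε n := by ring
        _ ≤ t := ht
    · rw [le_div_iff₀ (by positivity), one_mul]
      exact le_trans (by gcongr; norm_num) ht
  have := (summable_ramp (ε := ε) ha t).le_tsum n fun _ _ => zero_le
  rwa [min_eq_left h1, one_mul] at this

theorem rampGauge_le (ha : Summable a) {n : ℕ} {t : ℝ≥0} (ht : ∀ i < n, t ≤ 2 * ε i) :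
    rampGauge a ε t ≤ ∑' j, a (j + n) := by
  have hs := summable_ramp (ε := ε) ha t
  have h0 : ∑ i ∈ Finset.range n, min 1 (t / (2 * ε i) - 1) * a i = 0 := by
    refine Finset.sum_eq_zero fun i hi => ?_
    have : t / (2 * ε i) ≤ 1 := div_le_one_of_le₀ (ht i (Finset.mem_range.1 hi)) zero_le
    simp [tsub_eq_zero_of_le this]
  have h1 := NNReal.sum_add_tsum_nat_add n hs
  rw [h0, zero_add] at h1
  have h2 : Summable fun j => a (j + n) := (NNReal.summable_nat_add_iff n).2 ha
  rw [rampGauge, h1]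
  exact (NNReal.summable_of_le (fun j => ramp_le t (j + n)) h2).tsum_le_tsum
    (fun j => ramp_le t (j + n)) h2

theorem isGaugeFunction_rampGauge (ha : Summable a) (ha0 : ∀ n, 0 < a n) (hε : ∀ n, 0 < ε n)
    (hε0 : Tendsto ε atTop (𝓝 0)) : IsGaugeFunction (rampGauge a ε) where
  monotone := monotone_rampGauge ha
  rightContinuous _ := (continuous_rampGauge ha).continuousWithinAt
  eq_zero_iff t := by
    constructor
    · intro h
      by_contra ht
      have ht' : 0 < t / 4 := by have := pos_iff_ne_zero.2 ht; positivity
      obtain ⟨n, hn⟩ := (hε0.eventually_lt_const ht').exists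
      have h4 : 4 * ε n ≤ t := by
        have := (lt_div_iff₀ (by norm_num : (0 : ℝ≥0) < 4)).1 hn
        rw [mul_comm]
        exact this.le
      have := le_rampGauge ha (hε n) h4
      rw [h] at this
      exact (ha0 n).not_ge this
    · rintro rfl
      simp [rampGauge]

end Gauge

/-! ### Comparison with metric outer measures -/

theorem gaugeHausdorff_eq_mkMetric {X : Type*} [MetricSpace X] [MeasurableSpace X] [BorelSpace X]
    {h : ℝ≥0 → ℝ≥0} (h0 : h 0 = 0) (A : Set X) :
    gaugeHausdorff h A = MeasureTheory.Measure.mkMetric (fun d => (h d.toNNReal : ℝ≥0∞)) A := by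
  have hsup : ∀ U : Set X, ⨆ _ : U.Nonempty, (h (Metric.ediam U).toNNReal : ℝ≥0∞) =
      h (Metric.ediam U).toNNReal := fun U => by
    rcases U.eq_empty_or_nonempty with rfl | hU
    · simp [h0]
    · simp [hU]
  rw [MeasureTheory.Measure.mkMetric_apply]
  simp only [hsup]
  apply le_antisymm
  · exact iSup₂_le fun δ hδ => le_iSup₂_of_le (δ : ℝ≥0∞) (by exact_mod_cast hδ) le_rfl
  -- The scale r may be infinite, so it is capped at 1.
  · refine iSup₂_le fun r hr => le_iSup₂_of_le (min r 1).toNNReal ?_ ?_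
    · exact ENNReal.toNNReal_pos (by positivity) (ne_top_of_le_ne_top (by simp) (min_le_right _ _))
    · refine le_iInf fun U => le_iInf fun hU => le_iInf fun hd => ?_
      refine iInf_le_of_le U (iInf_le_of_le hU (iInf_le_of_le (fun i => (hd i).trans ?_) le_rfl))
      rw [ENNReal.coe_toNNReal (ne_top_of_le_ne_top (by simp) (min_le_right _ _))]
      exact min_le_left _ _

/-! ### Cluster schemes: counting and upper bounds -/

/-- A nested sequence of finite sets `F n` of centres of clusters of radius `ε n`. Each cluster of
level `n` contains exactly `k n` clusters of level `n + 1`, all clusters meet `K`, and they cover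
`K` up to the finite set `E`. -/
structure IsClusterScheme {X : Type*} [MetricSpace X] (K : Set X) (E : Finset X) (F : ℕ → Finset X)
    (ε : ℕ → ℝ≥0) (k : ℕ → ℕ) : Prop where
  pos : ∀ n, 0 < ε n
  half : ∀ n, 2 * ε (n + 1) ≤ ε n
  nonempty : (F 0).Nonempty
  two_le : ∀ n, 2 ≤ k n
  sep : ∀ n, ∀ x ∈ F n, ∀ y ∈ F n, x ≠ y → 6 * (ε n : ℝ) ≤ dist x y
  parent : ∀ n, ∀ y ∈ F (n + 1), ∃ x ∈ F n, dist y x + ε (n + 1) ≤ ε n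
  card_children : ∀ n, ∀ x ∈ F n, {y ∈ (F (n + 1) : Set X) | dist y x < ε n}.ncard = k n
  few : ∀ n, HasFewContractions (F n) (F (n + 1)) (ε n) (4 * ε (n + 1)) (k n)
  cover : ∀ n, ∀ p ∈ K, p ∉ E → ∃ x ∈ F n, dist p x < ε n
  meets : ∀ n, ∀ x ∈ F n, ∃ p ∈ K, dist p x < ε n

/-- The weights `1, 1 / N 0, 1 / N 1, …`. -/
noncomputable def scaleWeight (N : ℕ → ℕ) : ℕ → ℝ≥0
  | 0 => 1
  | n + 1 => (N n : ℝ≥0)⁻¹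

/-- The gauge function attached to a scheme with `(F n).card` clusters of radius `ε n`. -/
noncomputable def schemeGauge {X : Type*} (F : ℕ → Finset X) (ε : ℕ → ℝ≥0) : ℝ≥0 → ℝ≥0 :=
  rampGauge (scaleWeight fun n => (F n).card) ε

namespace IsClusterScheme

variable {X : Type*} [MetricSpace X] {K : Set X} {E : Finset X} {F : ℕ → Finset X} {ε : ℕ → ℝ≥0}
  {k : ℕ → ℕ}

/-- The separation constant 6 is spent as 1 + 4 + 1. -/
theorem center_unique (S : IsClusterScheme K E F ε k) {n : ℕ} {x y p q : X} (hx : x ∈ F n)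
    (hy : y ∈ F n) (hp : dist p x < ε n) (hq : dist q y < ε n) (hpq : dist p q < 4 * ε n) :
    x = y := by
  by_contra hxy
  have h1 := S.sep n x hx y hy hxy
  have h2 := dist_triangle4 x p q y
  rw [dist_comm x p] at h2
  linarith

theorem center_unique' (S : IsClusterScheme K E F ε k) {n : ℕ} {x y p : X} (hx : x ∈ F n)
    (hy : y ∈ F n) (hp : dist p x < ε n) (hq : dist p y < ε n) : x = y :=
  S.center_unique hx hy hp hq (by
    have : (0 : ℝ) < ε n := S.pos n
    rw [dist_self]
    positivity)

open Classical in
theorem card_filter_children (S : IsClusterScheme K E F ε k) {n : ℕ} {x : X} (hx : x ∈ F n) :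
    ((F (n + 1)).filter fun y => dist y x < ε n).card = k n := by
  rw [← S.card_children n x hx, ← Set.ncard_coe_finset]
  congr 1
  ext y
  simp

theorem _root_.dist_lt_of_dist_add_le {X : Type*} [MetricSpace X] {x y p : X} {r s : ℝ}
    (h : dist y x + r ≤ s) (hp : dist p y < r) : dist p x < s := by
  linarith [dist_triangle p y x]

theorem dist_center_lt (S : IsClusterScheme K E F ε k) {n : ℕ} {x y : X}
    (h : dist y x + ε (n + 1) ≤ ε n) : dist y x < ε n :=
  dist_lt_of_dist_add_le h (by rw [dist_self]; exact_mod_cast S.pos _)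

theorem card_succ (S : IsClusterScheme K E F ε k) (n : ℕ) :
    (F (n + 1)).card = (F n).card * k n := by
  classical
  have : F (n + 1) = (F n).biUnion fun x => (F (n + 1)).filter fun y => dist y x < ε n := by
    ext y
    simp only [Finset.mem_biUnion, Finset.mem_filter]
    constructor
    · intro hy
      obtain ⟨x, hx, h⟩ := S.parent n y hy
      exact ⟨x, hx, hy, S.dist_center_lt h⟩
    · rintro ⟨x, -, hy, -⟩
      exact hy
  rw [this, Finset.card_biUnion, Finset.sum_congr rfl fun x hx => S.card_filter_children hx]
  · simp
  · intro x hx y hy hxy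
    rw [Function.onFun, Finset.disjoint_left]
    intro p hp hq
    exact hxy (S.center_unique' hx hy (Finset.mem_filter.1 hp).2 (Finset.mem_filter.1 hq).2)

theorem card_pos (S : IsClusterScheme K E F ε k) (n : ℕ) : 0 < (F n).card := by
  induction n with
  | zero => exact S.nonempty.card_pos
  | succ n ih =>
    rw [S.card_succ]
    exact Nat.mul_pos ih (by linarith [S.two_le n])

theorem card_mul_two_pow_le (S : IsClusterScheme K E F ε k) (n j : ℕ) :
    (F n).card * 2 ^ j ≤ (F (j + n)).card := by
  induction j with
  | zero => simp
  | succ j ih =>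
    rw [show j + 1 + n = (j + n) + 1 by ring, S.card_succ, pow_succ, ← mul_assoc]
    exact Nat.mul_le_mul ih (S.two_le _)

theorem inv_card_le (S : IsClusterScheme K E F ε k) (n j : ℕ) :
    ((F (j + n)).card : ℝ≥0)⁻¹ ≤ ((F n).card : ℝ≥0)⁻¹ * (1 / 2) ^ j := by
  have h1 : (0 : ℝ≥0) < (F n).card := by exact_mod_cast S.card_pos n
  have h2 : ((F n).card : ℝ≥0) * 2 ^ j ≤ (F (j + n)).card := by
    exact_mod_cast S.card_mul_two_pow_le n j
  calc ((F (j + n)).card : ℝ≥0)⁻¹ ≤ (((F n).card : ℝ≥0) * 2 ^ j)⁻¹ := by gcongr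
    _ = _ := by rw [mul_inv, one_div, inv_pow]

theorem summable_geometric_half : Summable fun j : ℕ => (1 / 2 : ℝ≥0) ^ j :=
  NNReal.summable_geometric (by rw [div_lt_one] <;> norm_num)

theorem summable_inv_card (S : IsClusterScheme K E F ε k) (n : ℕ) :
    Summable fun j => ((F (j + n)).card : ℝ≥0)⁻¹ :=
  NNReal.summable_of_le (S.inv_card_le n) (summable_geometric_half.mul_left _)

theorem tsum_inv_card_le (S : IsClusterScheme K E F ε k) (n : ℕ) :
    ∑' j, ((F (j + n)).card : ℝ≥0)⁻¹ ≤ ((F n).card : ℝ≥0)⁻¹ * 2 := by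
  calc ∑' j, ((F (j + n)).card : ℝ≥0)⁻¹ ≤ ∑' j, ((F n).card : ℝ≥0)⁻¹ * (1 / 2) ^ j :=
        (S.summable_inv_card n).tsum_le_tsum (S.inv_card_le n) (summable_geometric_half.mul_left _)
    _ = ((F n).card : ℝ≥0)⁻¹ * 2 := by
        rw [NNReal.tsum_mul_left]
        congr 1
        rw [← NNReal.coe_inj, NNReal.coe_tsum]
        push_cast
        exact tsum_geometric_two

theorem summable_scaleWeight (S : IsClusterScheme K E F ε k) :
    Summable (scaleWeight fun n => (F n).card) :=
  (NNReal.summable_nat_add_iff 1).1 (S.summable_inv_card 0)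

theorem antitone (S : IsClusterScheme K E F ε k) : Antitone ε := by
  refine antitone_nat_of_succ_le fun n => ?_
  have h := S.half n
  rw [two_mul] at h
  exact le_self_add.trans h

theorem tendsto_zero (S : IsClusterScheme K E F ε k) : Tendsto ε atTop (𝓝 0) := by
  have h : ∀ n, ε n ≤ ε 0 * (1 / 2) ^ n := fun n => by
    induction n with
    | zero => simp
    | succ n ih =>
      have := (le_div_iff₀' (by norm_num : (0 : ℝ≥0) < 2)).2 (S.half n)
      calc ε (n + 1) ≤ ε n / 2 := this
        _ ≤ ε 0 * (1 / 2) ^ n / 2 := by gcongr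
        _ = ε 0 * (1 / 2) ^ (n + 1) := by rw [pow_succ, ← mul_assoc, mul_one_div]
  have h1 : Tendsto (fun n : ℕ => (1 / 2 : ℝ≥0) ^ n) atTop (𝓝 0) :=
    NNReal.tendsto_pow_atTop_nhds_zero_of_lt_one (by rw [div_lt_one] <;> norm_num)
  have h0 := h1.const_mul (ε 0)
  rw [mul_zero] at h0
  exact tendsto_of_tendsto_of_tendsto_of_le_of_le tendsto_const_nhds h0 (fun _ => zero_le) h

theorem isGaugeFunction (S : IsClusterScheme K E F ε k) : IsGaugeFunction (schemeGauge F ε) := by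
  refine isGaugeFunction_rampGauge S.summable_scaleWeight ?_ S.pos S.tendsto_zero
  rintro (_ | n)
  · exact one_pos
  · have : (0 : ℝ≥0) < (F n).card := by exact_mod_cast S.card_pos n
    exact inv_pos.2 this

theorem continuous_gauge (S : IsClusterScheme K E F ε k) : Continuous (schemeGauge F ε) :=
  continuous_rampGauge S.summable_scaleWeight

theorem gauge_le (S : IsClusterScheme K E F ε k) (n : ℕ) :
    schemeGauge F ε (2 * ε n) ≤ ((F n).card : ℝ≥0)⁻¹ * 2 := by
  -- The weights are shifted by one: ramps 0, …, n vanish at 2 * ε n, and the remaining weights are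
  -- 1 / N j for j ≥ n.
  refine (rampGauge_le S.summable_scaleWeight (n := n + 1) fun i hi => ?_).trans
    (S.tsum_inv_card_le n)
  gcongr
  exact S.antitone (Nat.lt_succ_iff.1 hi)

/-- A ball of radius ε (φ n) costs at most 2 / N (φ n), so the share of clusters needed to cover A
bounds its measure. -/
theorem gaugeHausdorff_le (S : IsClusterScheme K E F ε k) {A : Set X} {φ : ℕ → ℕ}
    (hφ : Tendsto φ atTop atTop) (B : ℕ → Finset X)
    (hA : ∀ᶠ n in atTop, ∀ p ∈ A, ∃ x ∈ B n, dist p x < ε (φ n)) {C : ℕ → ℝ≥0} {c : ℝ≥0}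
    (hC : Tendsto C atTop (𝓝 c))
    (hB : ∀ᶠ n in atTop, ((B n).card : ℝ≥0) * 2 ≤ C n * (F (φ n)).card) :
    gaugeHausdorff (schemeGauge F ε) A ≤ c := by
  borelize X
  have hdiam : ∀ (n : ℕ) (x : X), Metric.ediam (Metric.ball x (ε (φ n) : ℝ)) ≤ (2 * ε (φ n) : ℝ≥0) := by
    intro n x
    rw [← Metric.eball_coe, ENNReal.coe_mul, ENNReal.coe_ofNat]
    exact Metric.ediam_eball_le
  rw [gaugeHausdorff_eq_mkMetric (((S.isGaugeFunction).eq_zero_iff 0).2 rfl)]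
  refine (MeasureTheory.Measure.mkMetric_le_liminf_sum (X := X) (l := atTop) (ι := fun n => ↥(B n)) A
    (fun n => ((2 * ε (φ n) : ℝ≥0) : ℝ≥0∞)) ?_ (fun n x => Metric.ball (x : X) (ε (φ n) : ℝ))
    (Eventually.of_forall fun n i => hdiam n i) ?_ _).trans ?_
  · have h1 : Tendsto (fun n => 2 * ε (φ n)) atTop (𝓝 (2 * 0)) :=
      (S.tendsto_zero.comp hφ).const_mul 2
    rw [mul_zero] at h1
    exact ENNReal.tendsto_coe.2 h1
  · filter_upwards [hA] with n hn p hp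
    obtain ⟨x, hx, h⟩ := hn p hp
    exact mem_iUnion.2 ⟨⟨x, hx⟩, h⟩
  · have hC' : Tendsto (fun n => (C n : ℝ≥0∞)) atTop (𝓝 c) := ENNReal.tendsto_coe.2 hC
    rw [← hC'.liminf_eq]
    refine liminf_le_liminf ?_
    filter_upwards [hB] with n hn
    have hpos : (0 : ℝ≥0) < (F (φ n)).card := by exact_mod_cast S.card_pos _
    calc ∑ i : B n, ((schemeGauge F ε (Metric.ediam (Metric.ball (i : X) (ε (φ n)))).toNNReal :
          ℝ≥0) : ℝ≥0∞) ≤ ∑ _i : B n, ((((F (φ n)).card : ℝ≥0)⁻¹ * 2 : ℝ≥0) : ℝ≥0∞) := by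
          gcongr with i
          refine (S.isGaugeFunction.monotone ?_).trans (S.gauge_le _)
          exact ENNReal.toNNReal_mono ENNReal.coe_ne_top (hdiam n i)
      _ = (((B n).card * (((F (φ n)).card : ℝ≥0)⁻¹ * 2) : ℝ≥0) : ℝ≥0∞) := by
          simp [Finset.sum_const, nsmul_eq_mul]
      _ ≤ C n := by
          rw [ENNReal.coe_le_coe]
          calc ((B n).card : ℝ≥0) * (((F (φ n)).card : ℝ≥0)⁻¹ * 2)
              = (B n).card * 2 / (F (φ n)).card := by rw [div_eq_mul_inv]; ring
            _ ≤ C n := div_le_of_le_mul₀ zero_le zero_le hn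

end IsClusterScheme

/-! ### Null sets -/

theorem gaugeHausdorff_singleton {X : Type*} [MetricSpace X] {h : ℝ≥0 → ℝ≥0} (h0 : h 0 = 0)
    (x : X) : gaugeHausdorff h {x} = 0 := by
  refine le_antisymm (iSup₂_le fun δ _ => ?_) zero_le
  refine iInf_le_of_le (fun _ => {x}) (iInf_le_of_le (fun y hy => mem_iUnion.2 ⟨0, hy⟩)
    (iInf_le_of_le (fun _ => by simp) ?_))
  simp [h0]

theorem gaugeHausdorff_mono {X : Type*} [MetricSpace X] {h : ℝ≥0 → ℝ≥0} (h0 : h 0 = 0)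
    {A B : Set X} (hAB : A ⊆ B) : gaugeHausdorff h A ≤ gaugeHausdorff h B := by
  borelize X
  rw [gaugeHausdorff_eq_mkMetric h0, gaugeHausdorff_eq_mkMetric h0]
  exact MeasureTheory.measure_mono hAB

theorem gaugeHausdorff_union_le {X : Type*} [MetricSpace X] {h : ℝ≥0 → ℝ≥0} (h0 : h 0 = 0)
    (A B : Set X) : gaugeHausdorff h (A ∪ B) ≤ gaugeHausdorff h A + gaugeHausdorff h B := by
  borelize X
  simp only [gaugeHausdorff_eq_mkMetric h0]
  exact MeasureTheory.measure_union_le _ _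

theorem gaugeHausdorff_iUnion_null {X ι : Type*} [MetricSpace X] [Countable ι] {h : ℝ≥0 → ℝ≥0}
    (h0 : h 0 = 0) {A : ι → Set X} (hA : ∀ i, gaugeHausdorff h (A i) = 0) :
    gaugeHausdorff h (⋃ i, A i) = 0 := by
  borelize X
  simp only [gaugeHausdorff_eq_mkMetric h0] at hA ⊢
  exact MeasureTheory.measure_iUnion_null hA

theorem gaugeHausdorff_countable {X : Type*} [MetricSpace X] {h : ℝ≥0 → ℝ≥0} (h0 : h 0 = 0)
    {A : Set X} (hA : A.Countable) : gaugeHausdorff h A = 0 := by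
  have := hA.to_subtype
  rw [← Set.iUnion_of_singleton_coe A]
  exact gaugeHausdorff_iUnion_null h0 fun i => gaugeHausdorff_singleton h0 _

/-! ### Finiteness and positivity of the measure -/

namespace IsClusterScheme

variable {X : Type*} [MetricSpace X] {K : Set X} {E : Finset X} {F : ℕ → Finset X} {ε : ℕ → ℝ≥0}
  {k : ℕ → ℕ}

theorem gauge_zero (S : IsClusterScheme K E F ε k) : schemeGauge F ε 0 = 0 :=
  (S.isGaugeFunction.eq_zero_iff 0).2 rfl

theorem gaugeHausdorff_lt_top (S : IsClusterScheme K E F ε k) :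
    gaugeHausdorff (schemeGauge F ε) K < ∞ := by
  have h1 : gaugeHausdorff (schemeGauge F ε) (K \ E) ≤ (2 : ℝ≥0) := by
    refine S.gaugeHausdorff_le tendsto_id F (Eventually.of_forall fun n p hp => ?_)
      (C := fun _ => 2) tendsto_const_nhds (Eventually.of_forall fun n => ?_)
    · exact S.cover n p hp.1 (by simpa using hp.2)
    · rw [mul_comm, id]
  have h2 : gaugeHausdorff (schemeGauge F ε) (E : Set X) = 0 :=
    gaugeHausdorff_countable S.gauge_zero E.countable_toSet
  calc gaugeHausdorff (schemeGauge F ε) K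
      ≤ gaugeHausdorff (schemeGauge F ε) (E ∪ K \ E) :=
        gaugeHausdorff_mono S.gauge_zero (by rw [union_sdiff_self]; exact subset_union_right)
    _ ≤ _ := gaugeHausdorff_union_le S.gauge_zero _ _
    _ ≤ 0 + (2 : ℝ≥0) := by gcongr; exact h2.le
    _ < ∞ := by simp

open Classical in
/-- The centres of level `n` whose cluster ball meets `V`. -/
noncomputable def _root_.meeting (F : ℕ → Finset X) (ε : ℕ → ℝ≥0) (V : Set X) (n : ℕ) :
    Finset X :=
  (F n).filter fun x => ∃ p ∈ V, dist p x < ε n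

theorem _root_.mem_meeting {V : Set X} {n : ℕ} {x : X} :
    x ∈ meeting F ε V n ↔ x ∈ F n ∧ ∃ p ∈ V, dist p x < ε n := by
  simp [meeting]

theorem card_meeting_le_one (S : IsClusterScheme K E F ε k) {V : Set X} {n : ℕ}
    (hV : ∀ p ∈ V, ∀ q ∈ V, dist p q < 4 * ε n) : (meeting F ε V n).card ≤ 1 := by
  refine Finset.card_le_one.2 fun x hx y hy => ?_
  obtain ⟨hxF, p, hp, hpx⟩ := mem_meeting.1 hx
  obtain ⟨hyF, q, hq, hqy⟩ := mem_meeting.1 hy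
  exact S.center_unique hxF hyF hpx hqy (hV p hp q hq)

theorem card_meeting_succ_le (S : IsClusterScheme K E F ε k) (V : Set X) (n : ℕ) :
    (meeting F ε V (n + 1)).card ≤ (meeting F ε V n).card * k n := by
  classical
  have hsub : meeting F ε V (n + 1) ⊆ (meeting F ε V n).biUnion fun x =>
      (F (n + 1)).filter fun y => dist y x < ε n := by
    intro y hy
    obtain ⟨hyF, p, hp, hpy⟩ := mem_meeting.1 hy
    obtain ⟨x, hx, h⟩ := S.parent n y hyF
    exact Finset.mem_biUnion.2 ⟨x, mem_meeting.2 ⟨hx, p, hp, dist_lt_of_dist_add_le h hpy⟩,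
      Finset.mem_filter.2 ⟨hyF, S.dist_center_lt h⟩⟩
  refine (Finset.card_le_card hsub).trans (Finset.card_biUnion_le_card_mul _ _ _ fun x hx => ?_)
  exact (S.card_filter_children (mem_meeting.1 hx).1).le

theorem card_meeting_mul_le (S : IsClusterScheme K E F ε k) {V : Set X} {j m : ℕ}
    (hV : ∀ p ∈ V, ∀ q ∈ V, dist p q < 4 * ε j) (hjm : j ≤ m) :
    (meeting F ε V m).card * (F j).card ≤ (F m).card := by
  induction m, hjm using Nat.le_induction with
  | base => simpa using Nat.mul_le_mul_right (F j).card (S.card_meeting_le_one hV)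
  | succ m _ ih =>
    calc (meeting F ε V (m + 1)).card * (F j).card
        ≤ (meeting F ε V m).card * k m * (F j).card :=
          Nat.mul_le_mul_right _ (S.card_meeting_succ_le V m)
      _ = (meeting F ε V m).card * (F j).card * k m := by ring
      _ ≤ (F m).card * k m := Nat.mul_le_mul_right _ ih
      _ = (F (m + 1)).card := (S.card_succ m).symm

/-- Take the least n with 4 * ε n ≤ d. If n > 0, then V meets at most one cluster of level n - 1,
hence at most a share 1 / N (n - 1) of level m, which is the weight of the n-th ramp, fully risen at
d. For n = 0 the weight is 1. The summand 1 handles d < 4 * ε m. -/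
theorem card_meeting_le (S : IsClusterScheme K E F ε k) {V : Set X} {d : ℝ≥0}
    (hV : ∀ p ∈ V, ∀ q ∈ V, dist p q ≤ d) (m : ℕ) :
    ((meeting F ε V m).card : ℝ≥0) ≤ (F m).card * schemeGauge F ε d + 1 := by
  classical
  by_cases hex : ∃ n, n ≤ m ∧ 4 * ε n ≤ d
  · refine le_trans ?_ (le_self_add : (F m).card * schemeGauge F ε d ≤ _)
    obtain ⟨hnm, hn⟩ := Nat.find_spec hex
    have hmin := fun j => Nat.find_min (m := j) hex
    generalize Nat.find hex = n at hnm hn hmin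
    have hw := le_rampGauge S.summable_scaleWeight (S.pos n) hn
    rcases n with _ | j
    · calc ((meeting F ε V m).card : ℝ≥0) ≤ (F m).card := by
            exact_mod_cast Finset.card_le_card fun x hx => (mem_meeting.1 hx).1
        _ = (F m).card * 1 := (mul_one _).symm
        _ ≤ _ := by gcongr; exact hw
    · have hd : d < 4 * ε j := not_le.1 fun h => hmin j (Nat.lt_succ_self j) ⟨by omega, h⟩
      have h1 := S.card_meeting_mul_le (V := V) (j := j) (m := m)
        (fun p hp q hq => (hV p hp q hq).trans_lt (by exact_mod_cast hd)) (by omega)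
      have hpos : (0 : ℝ≥0) < (F j).card := by exact_mod_cast S.card_pos j
      calc ((meeting F ε V m).card : ℝ≥0) ≤ (F m).card * ((F j).card : ℝ≥0)⁻¹ := by
            rw [← div_eq_mul_inv, le_div_iff₀ hpos]
            exact_mod_cast h1
        _ ≤ _ := by gcongr; exact hw
  · refine le_trans ?_ (le_add_self : (1 : ℝ≥0) ≤ _)
    have hd : d < 4 * ε m := not_le.1 fun h => hex ⟨m, le_rfl, h⟩
    exact_mod_cast S.card_meeting_le_one fun p hp q hq =>
      (hV p hp q hq).trans_lt (by exact_mod_cast hd)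

/-- A mass distribution principle by counting: every cluster of level m meets some V i. Dividing the
count by N m makes the error `s.card` / N m vanish as m grows. -/
theorem one_le_sum_gauge (S : IsClusterScheme K E F ε k) {ι : Type*} (s : Finset ι)
    {V : ι → Set X} {d : ι → ℝ≥0} (hV : ∀ i, ∀ p ∈ V i, ∀ q ∈ V i, dist p q ≤ d i)
    (hK : K ⊆ ⋃ i ∈ s, V i) : 1 ≤ ∑ i ∈ s, schemeGauge F ε (d i) := by
  classical
  have hle : ∀ m, (1 : ℝ≥0) ≤ ∑ i ∈ s, schemeGauge F ε (d i) +
      s.card * (((F 0).card : ℝ≥0)⁻¹ * (1 / 2) ^ m) := by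
    intro m
    have hpos : (0 : ℝ≥0) < (F m).card := by exact_mod_cast S.card_pos m
    have hsub : F m ⊆ s.biUnion fun i => meeting F ε (V i) m := by
      intro x hx
      obtain ⟨p, hp, hpx⟩ := S.meets m x hx
      obtain ⟨i, hi, hpi⟩ := mem_iUnion₂.1 (hK hp)
      exact Finset.mem_biUnion.2 ⟨i, hi, mem_meeting.2 ⟨hx, p, hpi, hpx⟩⟩
    have h1 : ((F m).card : ℝ≥0) ≤ ∑ i ∈ s, ((meeting F ε (V i) m).card : ℝ≥0) := by
      exact_mod_cast (Finset.card_le_card hsub).trans Finset.card_biUnion_le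
    have h2 : ((F m).card : ℝ≥0) ≤ (F m).card * ∑ i ∈ s, schemeGauge F ε (d i) + s.card := by
      refine h1.trans ((Finset.sum_le_sum fun i _ => S.card_meeting_le (hV i) m).trans ?_)
      rw [Finset.sum_add_distrib, ← Finset.mul_sum]
      simp
    calc (1 : ℝ≥0) = (F m).card * ((F m).card : ℝ≥0)⁻¹ := (mul_inv_cancel₀ hpos.ne').symm
      _ ≤ ((F m).card * ∑ i ∈ s, schemeGauge F ε (d i) + s.card) * ((F m).card : ℝ≥0)⁻¹ := by
        gcongr
      _ = ∑ i ∈ s, schemeGauge F ε (d i) + s.card * ((F m).card : ℝ≥0)⁻¹ := by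
        field_simp
      _ ≤ _ := by
        gcongr
        exact S.inv_card_le 0 m
  have h1 : Tendsto (fun n : ℕ => (1 / 2 : ℝ≥0) ^ n) atTop (𝓝 0) :=
    NNReal.tendsto_pow_atTop_nhds_zero_of_lt_one (by rw [div_lt_one] <;> norm_num)
  have h2 := ((h1.const_mul ((F 0).card : ℝ≥0)⁻¹).const_mul (s.card : ℝ≥0)).const_add
    (∑ i ∈ s, schemeGauge F ε (d i))
  rw [mul_zero, mul_zero, add_zero] at h2
  exact ge_of_tendsto' h2 hle

/-- Continuity of the gauge allows the covering sets to be thickened to open ones at total cost 1 /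
2; compactness then reduces to finite covers. -/
theorem gaugeHausdorff_pos (S : IsClusterScheme K E F ε k) (hK : IsCompact K) :
    0 < gaugeHausdorff (schemeGauge F ε) K := by
  set h := schemeGauge F ε with hh
  have hhalf : (2 : ℝ≥0∞)⁻¹ ≠ 0 := by simp
  suffices hle : (2 : ℝ≥0∞)⁻¹ ≤ gaugeHausdorffPre h 1 K from
    (pos_iff_ne_zero.2 hhalf).trans_le (hle.trans (le_iSup₂_of_le 1 one_pos le_rfl))
  refine le_iInf fun U => le_iInf fun hU => le_iInf fun hd => ?_
  obtain ⟨η, hη, hsum⟩ := ENNReal.exists_pos_sum_of_countable hhalf ℕ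
  set d : ℕ → ℝ≥0 := fun i => (Metric.ediam (U i)).toNNReal with hdef
  have hdtop : ∀ i, (d i : ℝ≥0∞) = Metric.ediam (U i) := fun i =>
    ENNReal.coe_toNNReal (ne_top_of_le_ne_top ENNReal.coe_ne_top (hd i))
  have hr : ∀ i, ∃ r : ℝ≥0, 0 < r ∧ h (d i + 2 * r) ≤ h (d i) + η i := by
    intro i
    have hc : Tendsto (fun r : ℝ≥0 => h (d i + 2 * r)) (𝓝[>] 0) (𝓝 (h (d i + 2 * 0))) :=
      ((S.continuous_gauge.comp (by fun_prop : Continuous fun r : ℝ≥0 => d i + 2 * r)).tendsto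
        0).mono_left nhdsWithin_le_nhds
    rw [mul_zero, add_zero] at hc
    obtain ⟨r, hr, hr0⟩ := ((hc.eventually_le_const (lt_add_of_pos_right _ (hη i))).and
      self_mem_nhdsWithin).exists
    exact ⟨r, hr0, hr⟩
  choose r hr0 hr using hr
  obtain ⟨s, hs⟩ := hK.elim_finite_subcover (fun i => Metric.thickening (r i : ℝ) (U i))
    (fun i => Metric.isOpen_thickening) (hU.trans (iUnion_mono fun i =>
      Metric.self_subset_thickening (by exact_mod_cast hr0 i) _))
  have h1 := S.one_le_sum_gauge s (V := fun i => Metric.thickening (r i : ℝ) (U i))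
    (d := fun i => d i + 2 * r i) (fun i p hp q hq => by
      have h2 := (Metric.edist_le_ediam_of_mem hp hq).trans (Metric.ediam_thickening_le (r i))
      rw [← hdtop, edist_nndist] at h2
      exact_mod_cast h2) hs
  have h3 : (1 : ℝ≥0∞) ≤ ∑' i, (h (d i) : ℝ≥0∞) + 2⁻¹ := by
    calc (1 : ℝ≥0∞) ≤ ((∑ i ∈ s, (h (d i) + η i) : ℝ≥0) : ℝ≥0∞) := by
          exact_mod_cast h1.trans (Finset.sum_le_sum fun i _ => hr i)
      _ = ∑ i ∈ s, (h (d i) : ℝ≥0∞) + ∑ i ∈ s, (η i : ℝ≥0∞) := by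
          rw [← Finset.sum_add_distrib]; push_cast; rfl
      _ ≤ ∑' i, (h (d i) : ℝ≥0∞) + ∑' i, (η i : ℝ≥0∞) := by
          gcongr <;> exact ENNReal.sum_le_tsum s
      _ ≤ _ := by gcongr
  have h4 : (2 : ℝ≥0∞)⁻¹ + 2⁻¹ ≤ ∑' i, (h (d i) : ℝ≥0∞) + 2⁻¹ := by
    rwa [ENNReal.inv_two_add_inv_two]
  exact (ENNReal.add_le_add_iff_right (by simp)).1 h4

/-! ### Images under weak contractions -/

/-- To each child b reached by f, let α assign the child of x near a preimage. Two centre errors on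
each side give the slack 4 * ε (n + 1) in `few`. -/
theorem card_image_children_mul_le (S : IsClusterScheme K E F ε k) {f : K → X}
    (hf : ∀ u v, dist (f u) (f v) ≤ dist u v) {n : ℕ} {x : X} (hx : x ∈ F n) {B : Finset X}
    (hB : B ⊆ F (n + 1))
    (hBf : ∀ b ∈ B, ∃ u : K, (u : X) ∉ E ∧ dist (u : X) x < ε n ∧ dist (f u) b < ε (n + 1) ∧
      2 * (ε n : ℝ) ≤ dist (f u) u) :
    B.card * (F n).card ≤ k n := by
  rcases B.eq_empty_or_nonempty with rfl | ⟨b₀, hb₀⟩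
  · simp
  have h0 : ∀ b, ∃ a, b ∈ B → ∃ u : K, a ∈ F (n + 1) ∧ dist (u : X) a < ε (n + 1) ∧
      dist (u : X) x < ε n ∧ dist (f u) b < ε (n + 1) ∧ 2 * (ε n : ℝ) ≤ dist (f u) u := by
    intro b
    by_cases hb : b ∈ B
    · obtain ⟨u, huE, hux, hfu, hδ⟩ := hBf b hb
      obtain ⟨a, ha, hua⟩ := S.cover (n + 1) u u.2 huE
      exact ⟨a, fun _ => ⟨u, ha, hua, hux, hfu, hδ⟩⟩
    -- Outside B the value of α is irrelevant.
    · exact ⟨b, fun h => absurd h hb⟩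
  choose α hα using h0
  obtain ⟨y, hy, hb₀y⟩ := S.parent n b₀ (hB hb₀)
  obtain ⟨u₀, -, -, hu₀x, hfu₀, hδ⟩ := hα b₀ hb₀
  have hfu₀y := dist_lt_of_dist_add_le hb₀y hfu₀
  have hε : (0 : ℝ) < ε n := S.pos n
  refine S.few n x hx y hy ?_ B hB ?_ α ?_ ?_
  -- If y = x, both u₀ and f u₀ lie within ε n of x, against the displacement of at least 2 * ε n.
  · rintro rfl
    linarith [dist_triangle_right (f u₀) (u₀ : X) x]
  · intro b hb
    obtain ⟨z, hz, hbz⟩ := S.parent n b (hB hb)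
    obtain ⟨u, -, -, hux, hfu, -⟩ := hα b hb
    have hfuz := dist_lt_of_dist_add_le hbz hfu
    have : z = y := by
      refine S.center_unique hz hy hfuz hfu₀y ?_
      have h1 := hf u u₀
      rw [Subtype.dist_eq] at h1
      linarith [dist_triangle_right (u : X) (u₀ : X) x]
    exact this ▸ S.dist_center_lt hbz
  · intro b hb
    obtain ⟨u, hαF, huα, hux, -, -⟩ := hα b hb
    obtain ⟨z, hz, hαz⟩ := S.parent n _ hαF
    have : z = x := S.center_unique' hz hx (dist_lt_of_dist_add_le hαz huα) hux
    exact ⟨hαF, this ▸ S.dist_center_lt hαz⟩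
  · intro b hb b' hb'
    obtain ⟨u, -, huα, -, hfu, -⟩ := hα b hb
    obtain ⟨u', -, huα', -, hfu', -⟩ := hα b' hb'
    have h1 := hf u u'
    rw [Subtype.dist_eq] at h1
    have h2 := dist_triangle4 b (f u) (f u') b'
    have h4 := dist_triangle4 (u : X) (α b) (α b') u'
    rw [dist_comm b (f u)] at h2
    rw [dist_comm (α b') (u' : X)] at h4
    linarith

/-- Summing over the N n source clusters leaves at most k n clusters of level n + 1, out of N n * k
n. -/
theorem gaugeHausdorff_far_image (S : IsClusterScheme K E F ε k) {f : K → X}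
    (hf : ∀ u v, dist (f u) (f v) ≤ dist u v) {δ : ℝ} (hδ : 0 < δ) :
    gaugeHausdorff (schemeGauge F ε)
      {z | z ∈ K ∧ z ∉ E ∧ ∃ u : K, (u : X) ∉ E ∧ f u = z ∧ δ ≤ dist (f u) u} = 0 := by
  classical
  set A : Set X := {z | z ∈ K ∧ z ∉ E ∧ ∃ u : K, (u : X) ∉ E ∧ f u = z ∧ δ ≤ dist (f u) u}
  have hcard : ∀ n, 2 * (ε n : ℝ) ≤ δ → (meeting F ε A (n + 1)).card ≤ k n := by
    intro n hn
    let B : X → Finset X := fun x => (F (n + 1)).filter fun b => ∃ u : K, (u : X) ∉ E ∧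
      dist (u : X) x < ε n ∧ dist (f u) b < ε (n + 1) ∧ 2 * (ε n : ℝ) ≤ dist (f u) u
    have hsub : meeting F ε A (n + 1) ⊆ (F n).biUnion B := by
      intro b hb
      obtain ⟨hbF, z, ⟨-, -, u, huE, rfl, hu⟩, hzb⟩ := mem_meeting.1 hb
      obtain ⟨x, hx, hux⟩ := S.cover n u u.2 huE
      exact Finset.mem_biUnion.2 ⟨x, hx, Finset.mem_filter.2 ⟨hbF, u, huE, hux, hzb, hn.trans hu⟩⟩
    have h1 : (meeting F ε A (n + 1)).card * (F n).card ≤ k n * (F n).card :=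
      calc (meeting F ε A (n + 1)).card * (F n).card
          ≤ (∑ x ∈ F n, (B x).card) * (F n).card :=
            Nat.mul_le_mul_right _ ((Finset.card_le_card hsub).trans Finset.card_biUnion_le)
        _ = ∑ x ∈ F n, (B x).card * (F n).card := Finset.sum_mul _ _ _
        _ ≤ ∑ _x ∈ F n, k n := Finset.sum_le_sum fun x hx =>
            S.card_image_children_mul_le hf hx (Finset.filter_subset _ _) fun b hb =>
              (Finset.mem_filter.1 hb).2
        _ = k n * (F n).card := by rw [Finset.sum_const, smul_eq_mul, mul_comm]
    exact Nat.le_of_mul_le_mul_right h1 (S.card_pos n)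
  have hev : ∀ᶠ n in atTop, 2 * (ε n : ℝ) ≤ δ := by
    have h1 : Tendsto (fun n => 2 * (ε n : ℝ)) atTop (𝓝 (2 * 0)) :=
      (NNReal.tendsto_coe.2 S.tendsto_zero).const_mul 2
    rw [mul_zero] at h1
    exact h1.eventually_le_const hδ
  have hC : Tendsto (fun n => 2 * ((F n).card : ℝ≥0)⁻¹) atTop (𝓝 0) := by
    have := (NNReal.tendsto_atTop_zero_of_summable (S.summable_inv_card 0)).const_mul 2
    simpa using this
  refine le_antisymm ?_ zero_le
  have := S.gaugeHausdorff_le (A := A) (tendsto_add_atTop_nat 1)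
    (fun n => meeting F ε A (n + 1)) (Eventually.of_forall fun n p hp => ?_) hC ?_
  · simpa using this
  · obtain ⟨x, hx, h⟩ := S.cover (n + 1) p hp.1 hp.2.1
    exact ⟨x, mem_meeting.2 ⟨hx, p, hp, h⟩, h⟩
  · filter_upwards [hev] with n hn
    have hpos : (0 : ℝ≥0) < (F n).card := by exact_mod_cast S.card_pos n
    calc ((meeting F ε A (n + 1)).card : ℝ≥0) * 2 ≤ k n * 2 := by
          gcongr
          exact hcard n hn
      _ = 2 * ((F n).card : ℝ≥0)⁻¹ * (F (n + 1)).card := by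
          rw [S.card_succ]
          push_cast
          field_simp

/-- Strictness serves only to make the fixed point unique. Every other point is displaced by at
least 1 / (j + 1) for some j. -/
theorem gaugeHausdorff_inter_range (S : IsClusterScheme K E F ε k) {f : K → X}
    (hf : IsWeakContraction f) : gaugeHausdorff (schemeGauge F ε) (K ∩ range f) = 0 := by
  have hf' : ∀ u v, dist (f u) (f v) ≤ dist u v := fun u v => by
    rcases eq_or_ne u v with rfl | h
    · simp
    · exact (hf u v h).le
  have hfix : {u : K | f u = u}.Subsingleton := fun u hu v hv => by
    by_contra h
    have := hf u v h
    rw [hu, hv, Subtype.dist_eq] at this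
    exact lt_irrefl _ this
  have hEfin : {u : K | (u : X) ∈ E}.Finite :=
    E.finite_toSet.preimage Subtype.val_injective.injOn
  have hcount : ((E : Set X) ∪ f '' ({u : K | (u : X) ∈ E} ∪ {u : K | f u = u})).Countable :=
    (E.finite_toSet.union ((hEfin.union hfix.finite).image f)).countable
  have hsub : K ∩ range f ⊆ ((E : Set X) ∪ f '' ({u : K | (u : X) ∈ E} ∪ {u : K | f u = u})) ∪
      ⋃ j : ℕ, {z | z ∈ K ∧ z ∉ E ∧ ∃ u : K, (u : X) ∉ E ∧ f u = z ∧
        1 / ((j : ℝ) + 1) ≤ dist (f u) u} := by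
    rintro _ ⟨hzK, u, rfl⟩
    by_cases hz : f u ∈ E
    · exact Or.inl (Or.inl hz)
    by_cases hu : (u : X) ∈ E
    · exact Or.inl (Or.inr ⟨u, Or.inl hu, rfl⟩)
    by_cases hfu : f u = u
    · exact Or.inl (Or.inr ⟨u, Or.inr hfu, rfl⟩)
    obtain ⟨j, hj⟩ := exists_nat_one_div_lt (dist_pos.2 hfu)
    exact Or.inr (mem_iUnion.2 ⟨j, hzK, hz, u, hu, rfl, hj.le⟩)
  refine le_antisymm ((gaugeHausdorff_mono S.gauge_zero hsub).trans
    ((gaugeHausdorff_union_le S.gauge_zero _ _).trans_eq ?_)) zero_le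
  rw [gaugeHausdorff_countable S.gauge_zero hcount, gaugeHausdorff_iUnion_null S.gauge_zero
    fun j => S.gaugeHausdorff_far_image hf' (by positivity), add_zero]

end IsClusterScheme

/-! ### Isolated points and the perfect part -/

section Perfect

variable {X : Type*} [MetricSpace X]

/-- The largest open set without isolated points. -/
def perfectPart (X : Type*) [TopologicalSpace X] : Set X :=
  interior {x | (𝓝[≠] x).NeBot}

theorem dense_isolated_union_perfectPart :
    Dense ({x : X | IsOpen {x}} ∪ perfectPart X) := by
  have h : {x : X | IsOpen {x}} = {x : X | (𝓝[≠] x).NeBot}ᶜ := by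
    ext x
    simp [isOpen_singleton_iff_punctured_nhds, neBot_iff]
  intro x
  by_cases hx : x ∈ perfectPart X
  · exact subset_closure (Or.inr hx)
  · refine closure_mono subset_union_left ?_
    rw [h, closure_compl]
    exact hx

theorem isOpen_isolated_union_perfectPart :
    IsOpen ({x : X | IsOpen {x}} ∪ perfectPart X) := by
  refine IsOpen.union (isOpen_iff_mem_nhds.2 fun x hx => ?_) isOpen_interior
  exact mem_of_superset (hx.mem_nhds rfl) (singleton_subset_iff.2 hx)

theorem infinite_inter_of_mem_perfectPart {D V : Set X} (hD : Dense D) (hV : IsOpen V) {x : X}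
    (hx : x ∈ perfectPart X) (hxV : x ∈ V) : (V ∩ D).Infinite := by
  intro hfin
  have : (𝓝[≠] x).NeBot :=
    (interior_subset hx : x ∈ {x | (𝓝[≠] x).NeBot})
  have hinf : V.Infinite := infinite_of_mem_nhds x (hV.mem_nhds hxV)
  obtain ⟨y, hy, hyD⟩ := hD.inter_open_nonempty (V \ (V ∩ D)) (hV.sdiff hfin.isClosed)
    (hinf.sdiff hfin).nonempty
  exact hy.2 ⟨hy.1, hyD⟩

end Perfect

theorem HasFewContractions.mono {X : Type*} [MetricSpace X] {F F' : Finset X} {ε η η' : ℝ} {k : ℕ}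
    (h : HasFewContractions F F' ε η k) (hη : η' ≤ η) : HasFewContractions F F' ε η' k :=
  fun x hx y hy hxy B hB hBy α hα hd => h x hx y hy hxy B hB hBy α hα fun b hb b' hb' =>
    (hd b hb b' hb').trans (by gcongr)

/-- An infinite sequence lets nets of different sets be padded to a common length. -/
theorem TotallyBounded.exists_seq_approx {X : Type*} [MetricSpace X] {C : Set X}
    (hC : TotallyBounded C) (hne : C.Nonempty) {r : ℝ} (hr : 0 < r) :
    ∃ u : ℕ → X, (∀ i, u i ∈ C) ∧ ∃ n, ∀ p ∈ C, ∃ i < n, dist p (u i) < r := by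
  obtain ⟨t, htC, htfin, ht⟩ := Metric.finite_approx_of_totallyBounded hC r hr
  have htne : t.Nonempty := by
    obtain ⟨p, hp⟩ := hne
    obtain ⟨y, hy, -⟩ := mem_iUnion₂.1 (ht hp)
    exact ⟨y, hy⟩
  obtain ⟨u, rfl⟩ := htfin.countable.exists_eq_range htne
  have := htfin.to_subtype
  choose idx hidx using fun y : range u => y.2
  obtain ⟨n, hn⟩ := (Set.finite_range idx).bddAbove
  refine ⟨u, fun i => htC (mem_range_self i), n + 1, fun p hp => ?_⟩
  obtain ⟨y, hy, hpy⟩ := mem_iUnion₂.1 (ht hp)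
  refine ⟨idx ⟨y, hy⟩, Nat.lt_succ_of_le (hn (mem_range_self _)), ?_⟩
  rw [hidx]
  exact hpy

/-! ### Approximation and category in the hyperspace -/

section Approximation

variable {X : Type*} [MetricSpace X]

/-- The radius `2⁻ʲ` of scale `j`. -/
noncomputable def scaleRadius (j : ℕ) : ℝ≥0 := (1 / 2) ^ j

theorem scaleRadius_pos (j : ℕ) : 0 < scaleRadius j := by unfold scaleRadius; positivity

theorem tendsto_scaleRadius : Tendsto (fun j => (scaleRadius j : ℝ)) atTop (𝓝 0) := by
  simp only [scaleRadius, NNReal.coe_pow]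
  exact tendsto_pow_atTop_nhds_zero_of_lt_one (NNReal.coe_nonneg _) (by norm_num)

theorem two_mul_scaleRadius_le {i j : ℕ} (h : i < j) : 2 * scaleRadius j ≤ scaleRadius i := by
  have h1 : scaleRadius j ≤ scaleRadius (i + 1) :=
    pow_le_pow_of_le_one zero_le (by rw [div_le_one] <;> norm_num) h
  calc 2 * scaleRadius j ≤ 2 * scaleRadius (i + 1) := by gcongr
    _ = scaleRadius i := by
      rw [scaleRadius, scaleRadius, pow_succ, mul_comm (_ ^ i), ← mul_assoc]
      norm_num

/-- A triple `(E, F, j)` consisting of finitely many isolated points and finitely many well separated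
centres of balls of radius `2⁻ʲ` without isolated points, all taken from `D`. -/
def IsApproximation (D : Set X) (T : Finset X × Finset X × ℕ) : Prop :=
  (∀ x ∈ T.1, x ∈ D ∧ IsOpen {x}) ∧
    (∀ x ∈ T.2.1, x ∈ D ∧ Metric.ball x (scaleRadius T.2.2 : ℝ) ⊆ perfectPart X) ∧
    ∀ x ∈ T.2.1, ∀ y ∈ T.2.1, x ≠ y → 6 * (scaleRadius T.2.2 : ℝ) ≤ dist x y

/-- The compact sets that are approximated by `(E, F, j)`. -/
def approximated (T : Finset X × Finset X × ℕ) : Set (NonemptyCompacts X) :=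
  {K | (K : Set X) ⊆ (T.1 : Set X) ∪ ⋃ x ∈ T.2.1, Metric.ball x (scaleRadius T.2.2 : ℝ)} ∩
    ⋂ x ∈ T.2.1, {K | ((K : Set X) ∩ Metric.ball x (scaleRadius T.2.2 : ℝ)).Nonempty}

/-- The relation between consecutive levels of a cluster scheme. -/
def IsRefinement (T T' : Finset X × Finset X × ℕ) : Prop :=
  T'.1 = T.1 ∧ 2 * scaleRadius T'.2.2 ≤ scaleRadius T.2.2 ∧
    (∀ y ∈ T'.2.1, ∃ x ∈ T.2.1, dist y x + scaleRadius T'.2.2 ≤ scaleRadius T.2.2) ∧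
    ∃ k ≥ 2, (∀ x ∈ T.2.1, {y ∈ (T'.2.1 : Set X) | dist y x < scaleRadius T.2.2}.ncard = k) ∧
      HasFewContractions T.2.1 T'.2.1 (scaleRadius T.2.2) (4 * scaleRadius T'.2.2) k

theorem mem_approximated {T : Finset X × Finset X × ℕ} {K : NonemptyCompacts X} :
    K ∈ approximated T ↔
      (∀ p ∈ K, p ∉ T.1 → ∃ x ∈ T.2.1, dist p x < scaleRadius T.2.2) ∧
      ∀ x ∈ T.2.1, ∃ p ∈ K, dist p x < scaleRadius T.2.2 := by
  simp only [approximated, mem_inter_iff, mem_iInter]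
  refine and_congr ⟨fun h p hp hpE => ?_, fun h p hp => ?_⟩ Iff.rfl
  · obtain hp | hp := h hp
    · exact absurd hp hpE
    · simpa using hp
  · by_cases hpE : p ∈ T.1
    · exact Or.inl hpE
    · exact Or.inr (by simpa using h p hp hpE)

theorem IsApproximation.isOpen_approximated {D : Set X} {T : Finset X × Finset X × ℕ}
    (hT : IsApproximation D T) : IsOpen (approximated T) := by
  refine IsOpen.inter (NonemptyCompacts.isOpen_subsets_of_isOpen (IsOpen.union ?_ ?_)) ?_
  · rw [← Set.biUnion_of_singleton (T.1 : Set X)]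
    exact isOpen_biUnion fun x hx => (hT.1 x hx).2
  · exact isOpen_biUnion fun x _ => Metric.isOpen_ball
  · exact isOpen_biInter_finset fun x _ =>
      NonemptyCompacts.isOpen_inter_nonempty_of_isOpen Metric.isOpen_ball

theorem countable_setOf_isApproximation {D : Set X} (hD : D.Countable) :
    {T | IsApproximation D T}.Countable := by
  have hF : {F : Finset X | (F : Set X) ⊆ D}.Countable := by
    refine ((Set.countable_ofPred_finite_subset hD).preimage_of_injOn
      (f := fun F : Finset X => (F : Set X)) Finset.coe_injective.injOn).mono fun F hF => ?_
    exact ⟨F.finite_toSet, hF⟩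
  refine (hF.prod (hF.prod (Set.to_countable (univ : Set ℕ)))).mono fun T hT => ?_
  exact ⟨fun x hx => (hT.1 x hx).1, fun x hx => (hT.2.1 x hx).1, mem_univ _⟩

/-- A finite nonempty set as an element of `NonemptyCompacts X`. -/
def finiteCompact (s : Set X) (hs : s.Finite) (hne : s.Nonempty) : NonemptyCompacts X :=
  ⟨⟨s, hs.isCompact⟩, hne⟩

theorem dist_finiteCompact_le {s : Set X} {hs : s.Finite} {hne : s.Nonempty}
    {K : NonemptyCompacts X} {r : ℝ} (hr : 0 ≤ r) (h1 : ∀ x ∈ s, ∃ y ∈ K, dist x y ≤ r)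
    (h2 : ∀ x ∈ K, ∃ y ∈ s, dist x y ≤ r) : dist (finiteCompact s hs hne) K ≤ r :=
  Metric.hausdorffDist_le_of_mem_dist hr h1 h2

/-- A finite net of K can be moved into D within the dense open union of the isolated points and the
perfect part; the isolated points form E, the others F. -/
theorem exists_isApproximation_dist_lt {D : Set X} (hD : Dense D) (K : NonemptyCompacts X) {r : ℝ}
    (hr : 0 < r) : ∃ T, IsApproximation D T ∧ ∃ K' ∈ approximated T, dist K' K < r := by
  classical
  obtain ⟨t, htK, htfin, ht⟩ := Metric.finite_approx_of_totallyBounded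
    K.isCompact.totallyBounded (r / 4) (by positivity)
  have hdense := hD.inter_of_isOpen_right dense_isolated_union_perfectPart
    isOpen_isolated_union_perfectPart
  choose v hv hvr using fun p : X => hdense.exists_dist_lt p (show 0 < r / 4 by positivity)
  set s : Finset X := htfin.toFinset.image v with hs
  have hsmem : ∀ x ∈ s, ∃ p ∈ t, v p = x := fun x hx => by
    obtain ⟨p, hp, rfl⟩ := Finset.mem_image.1 hx
    exact ⟨p, htfin.mem_toFinset.1 hp, rfl⟩
  have hvs : ∀ p ∈ t, v p ∈ s := fun p hp =>
    Finset.mem_image_of_mem _ (htfin.mem_toFinset.2 hp)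
  set E := s.filter fun x => IsOpen {x}
  set F := s.filter fun x => ¬ IsOpen {x}
  have hFP : ∀ x ∈ F, x ∈ D ∧ x ∈ perfectPart X := fun x hx => by
    obtain ⟨hxs, hxo⟩ := Finset.mem_filter.1 hx
    obtain ⟨p, -, rfl⟩ := hsmem x hxs
    exact ⟨(hv p).1, (hv p).2.resolve_left hxo⟩
  have hj : ∀ᶠ j in atTop, (∀ x ∈ F, Metric.ball x (scaleRadius j : ℝ) ⊆ perfectPart X) ∧
      ∀ x ∈ F, ∀ y ∈ F, x ≠ y → 6 * (scaleRadius j : ℝ) ≤ dist x y := by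
    refine Eventually.and ?_ ?_
    · refine (Finset.eventually_all F).2 fun x hx => ?_
      obtain ⟨δ, hδ, hball⟩ := Metric.isOpen_iff.1
        (isOpen_interior : IsOpen (perfectPart X)) x (hFP x hx).2
      filter_upwards [tendsto_scaleRadius.eventually_le_const hδ] with j hj
      exact (Metric.ball_subset_ball hj).trans hball
    · refine (Finset.eventually_all F).2 fun x _ => (Finset.eventually_all F).2 fun y _ => ?_
      by_cases hxy : x = y
      · simp [hxy]
      · have h6 := tendsto_scaleRadius.const_mul 6
        rw [mul_zero] at h6
        filter_upwards [h6.eventually_le_const (dist_pos.2 hxy)] with j hj _ using hj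
  obtain ⟨j, hj1, hj2⟩ := hj.exists
  have hne : (s : Set X).Nonempty := by
    obtain ⟨p, hp⟩ := K.nonempty
    obtain ⟨y, hy, -⟩ := mem_iUnion₂.1 (ht hp)
    exact ⟨v y, hvs y hy⟩
  refine ⟨(E, F, j), ⟨fun x hx => ?_, fun x hx => ⟨(hFP x hx).1, hj1 x hx⟩, hj2⟩,
    finiteCompact s s.finite_toSet hne, ?_, ?_⟩
  · obtain ⟨hxs, hxo⟩ := Finset.mem_filter.1 hx
    obtain ⟨p, -, rfl⟩ := hsmem x hxs
    exact ⟨(hv p).1, hxo⟩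
  · have hself : ∀ x : X, dist x x < scaleRadius j := fun x => by
      rw [dist_self]
      exact_mod_cast scaleRadius_pos j
    refine mem_approximated.2 ⟨fun x hx hxE => ⟨x, ?_, hself x⟩, fun x hx =>
      ⟨x, (Finset.mem_filter.1 hx).1, hself x⟩⟩
    exact Finset.mem_filter.2 ⟨hx, fun h => hxE (Finset.mem_filter.2 ⟨hx, h⟩)⟩
  · refine (dist_finiteCompact_le (r := r / 2) (by positivity) ?_ ?_).trans_lt (by linarith)
    · intro x hx
      obtain ⟨p, hp, rfl⟩ := hsmem x hx
      exact ⟨p, htK hp, by rw [dist_comm]; linarith [hvr p]⟩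
    · intro x hx
      obtain ⟨p, hp, hxp⟩ := mem_iUnion₂.1 (ht hx)
      exact ⟨v p, hvs p hp, by
        linarith [hvr p, dist_triangle x p (v p), Metric.mem_ball.1 hxp]⟩

theorem IsApproximation.exists_isRefinement_dist_lt {D : Set X} (hD : Dense D)
    {T : Finset X × Finset X × ℕ} (hT : IsApproximation D T) {K : NonemptyCompacts X}
    (hK : K ∈ approximated T) {r : ℝ} (hr : 0 < r) :
    ∃ T', IsApproximation D T' ∧ IsRefinement T T' ∧ ∃ K' ∈ approximated T', dist K' K < r := by
  classical
  obtain ⟨E, F, j⟩ := T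
  obtain ⟨hE, hF, hsep⟩ := hT
  obtain ⟨hcov, hmeet⟩ := mem_approximated.1 hK
  simp only at hE hF hsep hcov hmeet
  set ε : ℝ := NNReal.toReal (scaleRadius j) with hεdef
  have hε : 0 < ε := NNReal.coe_pos.2 (scaleRadius_pos j)
  have hu : ∀ x : F, ∃ u : ℕ → X, (∀ i, u i ∈ (K : Set X) ∩ Metric.ball x ε) ∧
      ∃ n, ∀ p ∈ (K : Set X) ∩ Metric.ball x ε, ∃ i < n, dist p (u i) < r / 4 := fun x =>
    (K.isCompact.totallyBounded.subset inter_subset_left).exists_seq_approx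
      (hmeet x x.2) (by positivity)
  choose u hu n hn using hu
  -- One net length for all clusters, so that all have the same number of children; the 1 keeps it
  -- positive.
  set g := Finset.univ.sup n + 1 with hg
  have hng : ∀ x, n x ≤ g := fun x =>
    (Finset.le_sup (f := n) (Finset.mem_univ x)).trans (Nat.le_succ _)
  obtain ⟨c, hc, hcA⟩ := exists_injective_mem_of_infinite
    (fun a : F × Fin g => Metric.ball (u a.1 a.2) (r / 4) ∩ Metric.ball (a.1 : X) ε ∩ D)
    fun a => infinite_inter_of_mem_perfectPart hD (Metric.isOpen_ball.inter Metric.isOpen_ball)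
      ((hF a.1 a.1.2).2 (hu a.1 a.2).2) ⟨Metric.mem_ball_self (by positivity), (hu a.1 a.2).2⟩
  obtain ⟨F', k, hk, ε₀, hε₀, hF'D, hF'k, hF'c, hcF', hF'F, hF'sep, hfew⟩ :=
    exists_refinement (D := D) (F := F) (ε := ε)
      (fun x hx y hy hxy => (by gcongr; norm_num : 2 * ε ≤ 6 * ε).trans (hsep x hx y hy hxy))
      (Nat.succ_pos _) hc (fun a => (hcA a).1.2)
      (fun x hx z hz ρ hρ => infinite_inter_of_mem_perfectPart hD Metric.isOpen_ball
        ((hF x hx).2 hz) (Metric.mem_ball_self hρ)) (r := r / 4) (by positivity)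
  obtain ⟨j', hj', hjj'⟩ :=
    ((tendsto_scaleRadius.eventually_le_const hε₀).and (eventually_gt_atTop j)).exists
  have hε' : (0 : ℝ) < scaleRadius j' := scaleRadius_pos j'
  -- The nearby compact set keeps the points of K in E and replaces the rest by F'.
  have hKE : ((K : Set X) ∩ E ∪ F').Finite :=
    (E.finite_toSet.subset inter_subset_right).union F'.finite_toSet
  have hne : ((K : Set X) ∩ E ∪ F').Nonempty := by
    obtain ⟨p, hp⟩ := K.nonempty
    by_cases hpE : p ∈ E
    · exact ⟨p, Or.inl ⟨hp, hpE⟩⟩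
    · obtain ⟨x, hx, -⟩ := hcov p hp hpE
      obtain ⟨y, hy, -⟩ := hcF' (⟨x, hx⟩, ⟨0, Nat.succ_pos _⟩)
      exact ⟨y, Or.inr hy⟩
  have hparent : ∀ y ∈ F', ∃ x ∈ F, dist y x + scaleRadius j' ≤ ε := fun y hy => by
    obtain ⟨x, hx, h⟩ := hF'F y hy
    exact ⟨x, hx, by linarith⟩
  have hself : ∀ x : X, dist x x < scaleRadius j' := fun x => by rwa [dist_self]
  refine ⟨(E, F', j'), ⟨hE, fun y hy => ⟨hF'D y hy, ?_⟩, fun y hy y' hy' h => ?_⟩,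
    ⟨rfl, two_mul_scaleRadius_le hjj', hparent, k, hk, fun x hx => ?_, hfew.mono ?_⟩,
    finiteCompact _ hKE hne, mem_approximated.2 ⟨fun p hp hpE => ?_, fun x hx => ?_⟩, ?_⟩
  · obtain ⟨x, hx, h⟩ := hparent y hy
    refine Subset.trans (fun z hz => ?_) (hF x hx).2
    exact dist_lt_of_dist_add_le h hz
  · exact (mul_le_mul_of_nonneg_left hj' (by norm_num)).trans (hF'sep y hy y' hy' h)
  · rw [← hF'k x hx, ← Set.ncard_coe_finset]
    congr 1
    ext y
    simp [hεdef]
  · simp only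
    linarith
  · exact ⟨p, (hp.resolve_left fun h => hpE h.2), hself p⟩
  · exact ⟨x, Or.inr hx, hself x⟩
  -- One r / 4 each for the net of K, for moving it to c, and for splitting c.
  · refine (dist_finiteCompact_le (r := 3 * (r / 4)) (by positivity) ?_ ?_).trans_lt (by linarith)
    · rintro y (hy | hy)
      · exact ⟨y, hy.1, by rw [dist_self]; positivity⟩
      · obtain ⟨a, ha⟩ := hF'c y hy
        have h1 := Metric.mem_ball.1 (hcA a).1.1
        exact ⟨u a.1 a.2, (hu a.1 a.2).1, by linarith [dist_triangle y (c a) (u a.1 a.2)]⟩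
    · intro p hp
      by_cases hpE : p ∈ E
      · exact ⟨p, Or.inl ⟨hp, hpE⟩, by rw [dist_self]; positivity⟩
      · obtain ⟨x, hx, hpx⟩ := hcov p hp hpE
        obtain ⟨i, hi, hpi⟩ := hn ⟨x, hx⟩ p ⟨hp, hpx⟩
        set a : F × Fin g := (⟨x, hx⟩, ⟨i, hi.trans_le (hng _)⟩)
        obtain ⟨y, hy, hya⟩ := hcF' a
        have h1 := Metric.mem_ball'.1 (hcA a).1.1
        rw [dist_comm] at hya
        exact ⟨y, Or.inr hy, by linarith [dist_triangle4 p (u ⟨x, hx⟩ i) (c a) y]⟩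

theorem IsOpen.union_compl_closure_mem_residual {Y : Type*} [TopologicalSpace Y] {V : Set Y}
    (hV : IsOpen V) : V ∪ (closure V)ᶜ ∈ residual Y := by
  refine residual_of_dense_open (hV.union isClosed_closure.isOpen_compl) fun y => ?_
  by_cases hy : y ∈ closure V
  · exact closure_mono subset_union_left hy
  · exact subset_closure (Or.inr hy)

theorem eventually_residual_exists_isApproximation {D : Set X} (hD : Dense D) :
    ∀ᶠ K : NonemptyCompacts X in residual (NonemptyCompacts X),
      ∃ T, IsApproximation D T ∧ K ∈ approximated T := by
  have hopen : IsOpen (⋃ T ∈ {T | IsApproximation D T}, approximated T) :=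
    isOpen_biUnion fun T hT => IsApproximation.isOpen_approximated hT
  refine mem_of_superset (residual_of_dense_open hopen (Metric.dense_iff.2 fun K r hr => ?_))
    fun K hK => ?_
  · obtain ⟨T, hT, K', hK', hd⟩ := exists_isApproximation_dist_lt hD K hr
    exact ⟨K', hd, mem_iUnion₂.2 ⟨T, hT, hK'⟩⟩
  · obtain ⟨T, hT, hKT⟩ := mem_iUnion₂.1 hK
    exact ⟨T, hT, hKT⟩

/-- For each of the countably many T, let V be the open set of compact sets approximated by a
refinement of T. Density of refinements puts `approximated T` inside the closure of V, so every K in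
V ∪ (closure V)ᶜ satisfies the implication for T. -/
theorem eventually_residual_exists_isRefinement {D : Set X} (hD : Dense D) (hDc : D.Countable) :
    ∀ᶠ K : NonemptyCompacts X in residual (NonemptyCompacts X),
      ∀ T, IsApproximation D T → K ∈ approximated T →
        ∃ T', IsApproximation D T' ∧ IsRefinement T T' ∧ K ∈ approximated T' := by
  refine (eventually_countable_ball (countable_setOf_isApproximation hDc)).2 fun T hT => ?_
  have hopen : IsOpen (⋃ T' ∈ {T' | IsApproximation D T' ∧ IsRefinement T T'}, approximated T') :=
    isOpen_biUnion fun T' hT' => IsApproximation.isOpen_approximated hT'.1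
  refine mem_of_superset hopen.union_compl_closure_mem_residual ?_
  rintro K (hK | hK) hKT
  · obtain ⟨T', hT', hKT'⟩ := mem_iUnion₂.1 hK
    exact ⟨T', hT'.1, hT'.2, hKT'⟩
  · refine absurd (Metric.mem_closure_iff.2 fun r hr => ?_) hK
    obtain ⟨T', hT', href, K', hK', hd⟩ := hT.exists_isRefinement_dist_lt hD hKT hr
    exact ⟨K', mem_iUnion₂.2 ⟨T', ⟨hT', href⟩, hK'⟩, by rwa [dist_comm]⟩

theorem exists_isClusterScheme {D : Set X} {K : NonemptyCompacts X} {T₀ : Finset X × Finset X × ℕ}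
    (hT₀ : IsApproximation D T₀) (hK₀ : K ∈ approximated T₀) (hne : T₀.2.1.Nonempty)
    (hstep : ∀ T, IsApproximation D T → K ∈ approximated T →
      ∃ T', IsApproximation D T' ∧ IsRefinement T T' ∧ K ∈ approximated T') :
    ∃ E F ε k, IsClusterScheme (K : Set X) E F ε k := by
  choose! next hnext href hKnext using hstep
  let T : ℕ → Finset X × Finset X × ℕ := fun n => next^[n] T₀
  have hsucc : ∀ n, T (n + 1) = next (T n) := fun n => Function.iterate_succ_apply' next n T₀
  have hT : ∀ n, IsApproximation D (T n) ∧ K ∈ approximated (T n) := by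
    intro n
    induction n with
    | zero => exact ⟨hT₀, hK₀⟩
    | succ n ih =>
      rw [hsucc]
      exact ⟨hnext _ ih.1 ih.2, hKnext _ ih.1 ih.2⟩
  have hTref : ∀ n, IsRefinement (T n) (T (n + 1)) := fun n => by
    rw [hsucc]
    exact href _ (hT n).1 (hT n).2
  have hE : ∀ n, (T n).1 = T₀.1 := by
    intro n
    induction n with
    | zero => rfl
    | succ n ih => rw [(hTref n).1, ih]
  choose k hk hchild hfew using fun n => (hTref n).2.2.2
  exact ⟨T₀.1, fun n => (T n).2.1, fun n => scaleRadius (T n).2.2, k,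
    { pos := fun n => scaleRadius_pos _
      half := fun n => (hTref n).2.1
      nonempty := hne
      two_le := hk
      sep := fun n => (hT n).1.2.2
      parent := fun n => (hTref n).2.2.1
      card_children := hchild
      few := hfew
      cover := fun n p hp hpE => (mem_approximated.1 (hT n).2).1 p hp (by rwa [hE])
      meets := fun n => (mem_approximated.1 (hT n).2).2 }⟩

end Approximation

/-! ### The main theorem -/

theorem theorem4p2 {X : Type*} [MetricSpace X] [CompleteSpace X] [SeparableSpace X] :
    ∀ᶠ K : NonemptyCompacts X in residual (NonemptyCompacts X),
      (K : Set X).Finite ∨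
        ∃ h : ℝ≥0 → ℝ≥0, IsGaugeFunction h ∧ Continuous h ∧
          0 < gaugeHausdorff h (K : Set X) ∧ gaugeHausdorff h (K : Set X) < ∞ ∧
          ∀ f : K → X, IsWeakContraction f →
            gaugeHausdorff h ((K : Set X) ∩ range f) = 0 := by
  obtain ⟨D, hDc, hD⟩ := exists_countable_dense X
  filter_upwards [eventually_residual_exists_isApproximation hD,
    eventually_residual_exists_isRefinement hD hDc] with K ⟨T, hT, hKT⟩ hstep
  rcases T.2.1.eq_empty_or_nonempty with hemp | hne
  · left
    refine T.1.finite_toSet.subset fun p hp => ?_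
    by_contra hpE
    obtain ⟨x, hx, -⟩ := (mem_approximated.1 hKT).1 p hp hpE
    simp [hemp] at hx
  · right
    obtain ⟨E, F, ε, k, S⟩ := exists_isClusterScheme hT hKT hne hstep
    exact ⟨schemeGauge F ε, S.isGaugeFunction, S.continuous_gauge, S.gaugeHausdorff_pos K.isCompact,
      S.gaugeHausdorff_lt_top, fun f hf => S.gaugeHausdorff_inter_range hf⟩
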